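/- **Notation.** $b(r,s)=\binom rs$ and $c(r,h)=b(r-1+h,h)$ (the number of multi-indices of order $h$ in $r$ variables). Let $n,q,d,p$ be integers with $1\le p\le q\le n-1$, $q>1$ and $d>\frac{b(n,p)}{b(q,p)}$. Let $k_p^0$ be the greatest integer $k\ge0$ with $\frac{b(n,p)\,c(n,k)}{b(q,p)\,c(q,k)}\le d$, and $a^+=\max(a,0)$. **Webs.** Let $U\subset\mathbb C^n$ be open (a coordinate domain) with coordinates $x_1,\dots,x_n$, and let $\mathcal W=(\mathcal F_1,\dots,\mathcal F_d)$ be a (completely decomposed) $d$-web of codimension $q$ on $U$: a family of $d$ holomorphic foliations of codimension $q$ on $U$, each one being locally the family of level sets of a holomorphic submersion to $\mathbb C^q$. (Beyond $p$-ordinarity, defined below, no general position condition is imposed.) A holomorphic $p$-form $\omega$ is $\mathcal F_i$-basic if $i_X\omega=0$ and $L_X\omega=0$ for all vector fields $X$ tangent to $\mathcal F_i$. The space $Ab^p_m$ of germs of $p$-abelian relations at $m\in U$ consists of the families $(\omega_1,\dots,\omega_d)$ of germs at $m$ of holomorphic $p$-forms, $\omega_i$ being $\mathcal F_i$-basic,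 with $\sum_i\omega_i=0$; the $p$-rank of $\mathcal W$ is $r_p=\sup_{m\in U}\dim_{\mathbb C} Ab_m^p$. A formal $p$-abelian relation of order $k$ at $m$ is a family $(a_1,\dots,a_d)$, where $a_i$ is the $k$-jet at $m$ of an $\mathcal F_i$-basic holomorphic $p$-form, with $\sum_i a_i=0$; these form a vector space $(R_k^p)_m$, and $R_k^p=\bigcup_{m\in U}(R_k^p)_m$ is a subset of the total space of the (trivial) bundle of $d$-tuples of $k$-jets of $p$-forms on $U$. **Ordinary webs.** Near $m\in U$ let $u_i=(u_{i,1},\dots,u_{i,q})$ be holomorphic functions, constant along $\mathcal F_i$, with $du_{i,1}\wedge\dots\wedge du_{i,q}\ne0$. For $k\ge0$ let $P_k(m)$ be the matrix of size $b(n,p)c(n,k)\times d\,b(q,p)c(q,k)$ with rows indexed by $(B,L)$ and columns indexed by $(i,A,K)$, where $B=(\lambda_1<\dots<\lambda_p)\subset\{1,\dots,n\}$, $A=(\alpha_1<\dots<\alpha_p)\subset\{1,\dots,q\}$, $1\le i\le d$, and $L$, $K$ are multi-indices of order $k$ in $n$, resp. $q$, variables, whose entries are $$\det\Bigl(\frac{\partial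 u_{i,\alpha_r}}{\partial x_{\lambda_s}}(m)\Bigr)_{1\le r,s\le p}\cdot N_L^K(\mathcal F_i),$$ where $N_L^K(\mathcal F_i)$ is the coefficient of $X^K$ in $\prod_{\lambda=1}^n\Bigl(\sum_{\alpha=1}^q\frac{\partial u_{i,\alpha}}{\partial x_\lambda}(m)\,X_\alpha\Bigr)^{L_\lambda}$. The web is $p$-ordinary if, for every $m\in U$ and every $k\ge0$, the matrix $P_k(m)$ has maximal rank $\min\bigl(b(n,p)c(n,k),\,d\,b(q,p)c(q,k)\bigr)$ (this does not depend on the choice of the $u_i$). **Theorem.** Suppose that $\mathcal W$ is $p$-ordinary. Then: (i) For every $k\le k_p^0$, the set $R_k^p$ of formal $p$-abelian relations of order $k$ is a holomorphic vector bundle over $U$ (a holomorphic subbundle of the bundle of $d$-tuples of $k$-jets of $p$-forms), of rank $$b(q,p)\sum_{h=0}^k c(q,h)\Bigl(d-\frac{b(n,p)\,c(n,h)}{b(q,p)\,c(q,h)}\Bigr).$$ (ii) The $p$-rank $r_p$ of $\mathcal W$ is finite and $$r_p\le\pi_p^0(n,d,q):=b(q,p)\sum_{h\ge0}c(q,h)\Bigl(d-\frac{b(n,p)\,c(n,h)}{b(q,p)\,c(q,h)}\Bigr)^+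 .$$ -/

import Mathlib

open Topology

namespace OrdinaryWeb

/-! ### Numerical data -/

/-- The binomial coefficient `b(r,s) = r! / (s! (r-s)!)`. -/
abbrev b (r s : ℕ) : ℕ := Nat.choose r s

/-- `c(r,h) = b(r-1+h,h)`: the dimension of the space of homogeneous polynomials of degree `h`
in `r` indeterminates (`r ≥ 1`). -/
def c (r h : ℕ) : ℕ := b (r - 1 + h) h

/-- The ratio `b(n,p) c(n,h) / (b(q,p) c(q,h))`. -/
def ratio (n q p h : ℕ) : ℚ :=
  ((b n p : ℚ) * (c n h : ℚ)) / ((b q p : ℚ) * (c q h : ℚ))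

/-- The integer `k_p^0`: the greatest `k` such that `b(n,p) c(n,k) / (b(q,p) c(q,k)) ≤ d`
(see `isGreatest_criticalOrder`). -/
noncomputable def criticalOrder (n q d p : ℕ) : ℕ :=
  sSup {k : ℕ | ratio n q p k ≤ (d : ℚ)}

/-- The number `b(q,p) ∑_{h=0}^k c(q,h) (d - b(n,p) c(n,h) / (b(q,p) c(q,h)))`. -/
def jetRank (n q d p k : ℕ) : ℚ :=
  (b q p : ℚ) * ∑ h ∈ Finset.range (k + 1), (c q h : ℚ) * ((d : ℚ) - ratio n q p h)

/-- The bound `π_p^0(n,d,q) = b(q,p) ∑_{h ≥ 0} c(q,h) (d - b(n,p) c(n,h) / (b(q,p) c(q,h)))^+`.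
Only finitely many terms are nonzero when `1 ≤ p ≤ q < n`, see `finite_support_rankBound`. -/
noncomputable def rankBound (n d q p : ℕ) : ℚ :=
  (b q p : ℚ) * ∑ᶠ h : ℕ, (c q h : ℚ) * max ((d : ℚ) - ratio n q p h) 0

theorem le_ratio {n q p : ℕ} (hp : 1 ≤ p) (hpq : p ≤ q) (hqn : q < n) (h : ℕ) :
    ((q : ℚ) + h) / q ≤ ratio n q p h := by
  obtain ⟨r, rfl⟩ : ∃ r, q = r + 1 := ⟨q - 1, by omega⟩
  obtain ⟨s, rfl⟩ : ∃ s, n = r + 2 + s := ⟨n - (r + 2), by omega⟩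
  have hb : b (r + 1) p ≤ b (r + 2 + s) p := Nat.choose_le_choose p (by omega)
  have hb0 : 0 < b (r + 1) p := Nat.choose_pos hpq
  have hc0 : 0 < c (r + 1) h := Nat.choose_pos (by omega)
  have hc1 : c (r + 2) h ≤ c (r + 2 + s) h := Nat.choose_le_choose h (by omega)
  have hc2 : c (r + 2) h * (r + 1) = c (r + 1) h * (r + 1 + h) := by
    have e1 : c (r + 2) h = Nat.choose (r + h + 1) (r + 1) := by
      unfold c b
      rw [show r + 2 - 1 + h = (r + 1) + h by omega, Nat.choose_symm_add.symm,
        show r + 1 + h = r + h + 1 by omega]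
    have e2 : c (r + 1) h = Nat.choose (r + h) r := by
      unfold c b
      rw [show r + 1 - 1 + h = r + h by omega, Nat.choose_symm_add.symm]
    rw [e1, e2]
    have := Nat.add_one_mul_choose_eq (r + h) r
    rw [← this]
    ring
  have hmain : (r + 1 + h) * (b (r + 1) p * c (r + 1) h)
      ≤ (b (r + 2 + s) p * c (r + 2 + s) h) * (r + 1) :=
    calc (r + 1 + h) * (b (r + 1) p * c (r + 1) h)
        = b (r + 1) p * (c (r + 1) h * (r + 1 + h)) := by ring
      _ = b (r + 1) p * c (r + 2) h * (r + 1) := by rw [← hc2]; ring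
      _ ≤ _ := Nat.mul_le_mul_right _ (Nat.mul_le_mul hb hc1)
  unfold ratio
  rw [div_le_div_iff₀ (by positivity) (by positivity)]
  exact_mod_cast hmain

/-- The number `k_p^0` is well defined as soon as `d ≥ b(n,p) / b(q,p)`. -/
theorem isGreatest_criticalOrder {n q d p : ℕ} (hp : 1 ≤ p) (hpq : p ≤ q) (hqn : q < n)
    (hd : (b n p : ℚ) / (b q p : ℚ) ≤ d) :
    IsGreatest {k : ℕ | ratio n q p k ≤ (d : ℚ)} (criticalOrder n q d p) := by
  have hne : {k : ℕ | ratio n q p k ≤ (d : ℚ)}.Nonempty := ⟨0, by simpa [ratio, c, b] using hd⟩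
  have hbd : BddAbove {k : ℕ | ratio n q p k ≤ (d : ℚ)} := by
    refine ⟨d * q, fun k hk => ?_⟩
    have h1 := (le_ratio hp hpq hqn k).trans hk
    have hq : (0 : ℚ) < q := by exact_mod_cast (by omega : 0 < q)
    rw [div_le_iff₀ hq] at h1
    have h2 : (k : ℚ) ≤ (d * q : ℕ) := by push_cast; linarith
    exact_mod_cast h2
  exact ⟨Nat.sSup_mem hne hbd, fun k hk => le_csSup hbd hk⟩

theorem finite_support_rankBound {n q p : ℕ} (hp : 1 ≤ p) (hpq : p ≤ q) (hqn : q < n) (d : ℕ) :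
    (Function.support fun h : ℕ => (c q h : ℚ) * max ((d : ℚ) - ratio n q p h) 0).Finite := by
  refine (Set.finite_Iic (d * q)).subset fun k hk => ?_
  have hq : (0 : ℚ) < q := by exact_mod_cast (by omega : 0 < q)
  have h1 := le_ratio hp hpq hqn k
  by_contra hlt
  apply hk
  have h2 : ((d * q : ℕ) : ℚ) < k := by exact_mod_cast not_le.mp hlt
  rw [div_le_iff₀ hq] at h1
  push_cast at h2
  have h3 : (d : ℚ) ≤ ratio n q p k := by
    by_contra h4
    have := mul_lt_mul_of_pos_right (not_le.mp h4) hq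
    linarith
  simp [max_eq_right (sub_nonpos.mpr h3)]

/-! ### Foliations and basic forms

The ambient space is a coordinate domain: an open subset `U` of `ℂ^n`.  "Holomorphic" is
expressed by analyticity (existence of local convergent power series expansions). -/

/-- The type of `p`-covectors on `ℂ^n`; a differential `p`-form is a function into it. -/
abbrev Cov (n p : ℕ) : Type := (Fin n → ℂ) [⋀^Fin p]→L[ℂ] ℂ

/-- A holomorphic foliation of codimension `q` on the open set `U ⊆ ℂ^n`, given by its tangent
spaces: near each point of `U` these are the kernels of the differentials of a holomorphic
submersion to `ℂ^q`.  (The values of `tangent` outside `U` are irrelevant.) -/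
structure Foliation (n q : ℕ) (U : Set (Fin n → ℂ)) where
  tangent : (Fin n → ℂ) → Submodule ℂ (Fin n → ℂ)
  exists_submersion : ∀ m ∈ U, ∃ u : (Fin n → ℂ) → (Fin q → ℂ), ∀ᶠ x in 𝓝 m,
    AnalyticAt ℂ u x ∧ Function.Surjective (fderiv ℂ u x) ∧
      LinearMap.ker (fderiv ℂ u x : (Fin n → ℂ) →ₗ[ℂ] (Fin q → ℂ)) = tangent x

/-- A completely decomposed `d`-web of codimension `q` on `U`: a family of `d` foliations. -/
abbrev Web (n q d : ℕ) (U : Set (Fin n → ℂ)) : Type := Fin d → Foliation n q U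

variable {n q d : ℕ} {U : Set (Fin n → ℂ)}

/-- `u = (u_1, …, u_q)` is a generating system of basic functions of the foliation `F` near `m`:
the functions `u_α` are holomorphic, constant along `F` (their differentials vanish on the tangent
space), and `du_1 ∧ ⋯ ∧ du_q ≠ 0` (the differentials are independent). -/
def IsGeneratingSystem (F : Foliation n q U) (m : Fin n → ℂ)
    (u : (Fin n → ℂ) → (Fin q → ℂ)) : Prop :=
  ∀ᶠ x in 𝓝 m, AnalyticAt ℂ u x ∧ (∀ v ∈ F.tangent x, fderiv ℂ u x v = 0) ∧
    Function.Surjective (fderiv ℂ u x)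

/-- `ω` is semi-basic for `F` at `x`: `i_v ω = 0` for every `v` tangent to `F`. -/
def IsSemibasicAt (F : Foliation n q U) {p : ℕ} (ω : (Fin n → ℂ) → Cov n p)
    (x : Fin n → ℂ) : Prop :=
  ∀ w : Fin p → (Fin n → ℂ), (∃ j, w j ∈ F.tangent x) → ω x w = 0

/-- `i_v dω = 0` at `x` for every `v` tangent to `F`.  If `ω` is semi-basic and `X` is a vector
field tangent to `F`, then `i_X ω = 0`, so that `L_X ω = i_X dω + d i_X ω = i_X dω`: for a
semi-basic form this condition says precisely that `ω` is invariant along `F`. -/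
def IsInvariantAt (F : Foliation n q U) {p : ℕ} (ω : (Fin n → ℂ) → Cov n p)
    (x : Fin n → ℂ) : Prop :=
  ∀ v ∈ F.tangent x, ∀ w : Fin p → (Fin n → ℂ),
    extDeriv ω x (Fin.cons v w : Fin (p + 1) → (Fin n → ℂ)) = 0

/-- `ω` is, near `m`, a holomorphic `F`-basic form: semi-basic and invariant. -/
def IsBasicNear (F : Foliation n q U) {p : ℕ} (m : Fin n → ℂ)
    (ω : (Fin n → ℂ) → Cov n p) : Prop :=
  ∀ᶠ x in 𝓝 m, AnalyticAt ℂ ω x ∧ IsSemibasicAt F ω x ∧ IsInvariantAt F ω x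

theorem IsBasicNear.analyticAt {F : Foliation n q U} {p : ℕ} {m : Fin n → ℂ}
    {ω : (Fin n → ℂ) → Cov n p} (h : IsBasicNear F m ω) : AnalyticAt ℂ ω m :=
  h.self_of_nhds.1

theorem IsBasicNear.zero (F : Foliation n q U) (p : ℕ) (m : Fin n → ℂ) :
    IsBasicNear F m (0 : (Fin n → ℂ) → Cov n p) := by
  refine Filter.Eventually.of_forall fun x => ⟨analyticAt_const, fun w _ => rfl, fun v _ w => ?_⟩
  have h := extDeriv_smul (𝕜 := ℂ) (x := x) (0 : ℂ) (0 : (Fin n → ℂ) → Cov n p)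
  rw [zero_smul, zero_smul] at h
  rw [h]; rfl

theorem IsBasicNear.add {F : Foliation n q U} {p : ℕ} {m : Fin n → ℂ}
    {ω η : (Fin n → ℂ) → Cov n p} (hω : IsBasicNear F m ω) (hη : IsBasicNear F m η) :
    IsBasicNear F m (ω + η) := by
  filter_upwards [hω, hη] with x h1 h2
  refine ⟨h1.1.add h2.1, fun w hw => ?_, fun v hv w => ?_⟩
  · have e1 := h1.2.1 w hw
    have e2 := h2.2.1 w hw
    simp [e1, e2]
  · rw [extDeriv_add h1.1.differentiableAt h2.1.differentiableAt]
    have e1 := h1.2.2 v hv w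
    have e2 := h2.2.2 v hv w
    simp [e1, e2]

theorem IsBasicNear.smul {F : Foliation n q U} {p : ℕ} {m : Fin n → ℂ}
    {ω : (Fin n → ℂ) → Cov n p} (a : ℂ) (hω : IsBasicNear F m ω) :
    IsBasicNear F m (a • ω) := by
  filter_upwards [hω] with x h1
  refine ⟨analyticAt_const.smul h1.1, fun w hw => ?_, fun v hv w => ?_⟩
  · have e1 := h1.2.1 w hw
    simp [e1]
  · rw [extDeriv_smul]
    have e1 := h1.2.2 v hv w
    simp [e1]

/-! ### Abelian relations and the `p`-rank -/

/-- The space of germs at `m` of holomorphic `F`-basic `p`-forms. -/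
def basicGerms (F : Foliation n q U) (p : ℕ) (m : Fin n → ℂ) :
    Submodule ℂ (Filter.Germ (𝓝 m) (Cov n p)) where
  carrier := {σ | ∃ ω : (Fin n → ℂ) → Cov n p, IsBasicNear F m ω ∧ σ = (ω : Filter.Germ (𝓝 m) _)}
  zero_mem' := ⟨0, IsBasicNear.zero F p m, rfl⟩
  add_mem' := by
    rintro _ _ ⟨ω, hω, rfl⟩ ⟨η, hη, rfl⟩
    exact ⟨ω + η, hω.add hη, rfl⟩
  smul_mem' := by
    rintro a _ ⟨ω, hω, rfl⟩
    exact ⟨a • ω, hω.smul a, rfl⟩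

/-- The space `Ab^p_m` of germs at `m` of `p`-abelian relations: families `(ω_i)` of germs of
holomorphic `p`-forms, `ω_i` basic for the `i`-th foliation, with `∑ ω_i = 0`. -/
def abelianRelations (W : Web n q d U) (p : ℕ) (m : Fin n → ℂ) :
    Submodule ℂ (Fin d → Filter.Germ (𝓝 m) (Cov n p)) where
  carrier := {σ | (∀ i, σ i ∈ basicGerms (W i) p m) ∧ ∑ i, σ i = 0}
  zero_mem' := ⟨fun i => (basicGerms (W i) p m).zero_mem, by simp⟩
  add_mem' := by
    rintro σ τ ⟨h1, h2⟩ ⟨h3, h4⟩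
    exact ⟨fun i => (basicGerms (W i) p m).add_mem (h1 i) (h3 i), by
      simp [Finset.sum_add_distrib, h2, h4]⟩
  smul_mem' := by
    rintro a σ ⟨h1, h2⟩
    exact ⟨fun i => (basicGerms (W i) p m).smul_mem a (h1 i), by
      simp [← Finset.smul_sum, h2]⟩

/-- The `p`-rank of the web: the supremum over `m ∈ U` of the (possibly infinite) dimensions of
the spaces of germs at `m` of `p`-abelian relations. -/
noncomputable def pRank (W : Web n q d U) (p : ℕ) : ℕ∞ :=
  ⨆ m : U, Cardinal.toENat (Module.rank ℂ (abelianRelations W p (m : Fin n → ℂ)))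

/-! ### Formal abelian relations of order `k` -/

/-- The space of jets of order `k` of `p`-forms at a point of `ℂ^n`: a jet is the list of the
iterated derivatives of orders `0, …, k` of (the coefficients of) the form. -/
def JetSpace (n p k : ℕ) : Type :=
  (j : Fin (k + 1)) → ContinuousMultilinearMap ℂ (fun _ : Fin (j : ℕ) => (Fin n → ℂ)) (Cov n p)

noncomputable instance JetSpace.instNormedAddCommGroup (n p k : ℕ) :
    NormedAddCommGroup (JetSpace n p k) :=
  inferInstanceAs (NormedAddCommGroup ((j : Fin (k + 1)) →
    ContinuousMultilinearMap ℂ (fun _ : Fin (j : ℕ) => (Fin n → ℂ)) (Cov n p)))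

noncomputable instance JetSpace.instNormedSpace (n p k : ℕ) :
    NormedSpace ℂ (JetSpace n p k) :=
  inferInstanceAs (NormedSpace ℂ ((j : Fin (k + 1)) →
    ContinuousMultilinearMap ℂ (fun _ : Fin (j : ℕ) => (Fin n → ℂ)) (Cov n p)))

/-- The jet `j^k_m ω` of order `k` at `m` of the form `ω`. -/
noncomputable def jet {p : ℕ} (k : ℕ) (ω : (Fin n → ℂ) → Cov n p) (m : Fin n → ℂ) :
    JetSpace n p k :=
  fun j => iteratedFDeriv ℂ (j : ℕ) ω m

/-- The space of jets of order `k` at `m` of holomorphic `F`-basic `p`-forms. -/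
def basicJets (F : Foliation n q U) (p k : ℕ) (m : Fin n → ℂ) :
    Submodule ℂ (JetSpace n p k) where
  carrier := {a | ∃ ω : (Fin n → ℂ) → Cov n p, IsBasicNear F m ω ∧ a = jet k ω m}
  zero_mem' := ⟨0, IsBasicNear.zero F p m, by
    funext j
    simp [jet]
    rfl⟩
  add_mem' := by
    rintro _ _ ⟨ω, hω, rfl⟩ ⟨η, hη, rfl⟩
    refine ⟨ω + η, hω.add hη, ?_⟩
    funext j
    exact (iteratedFDeriv_add_apply hω.analyticAt.contDiffAt hη.analyticAt.contDiffAt).symm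
  smul_mem' := by
    rintro a _ ⟨ω, hω, rfl⟩
    refine ⟨a • ω, hω.smul a, ?_⟩
    funext j
    exact (iteratedFDeriv_const_smul_apply hω.analyticAt.contDiffAt).symm

/-- The fibre at `m` of `R_k^p`: the `p`-abelian relations of the web that are formal of order `k`
at `m`, that is, families `(a_i)` where `a_i` is a jet of order `k` at `m` of `p`-forms basic for
the `i`-th foliation, with `∑ a_i = 0`. -/
def formalRelations (W : Web n q d U) (p k : ℕ) (m : Fin n → ℂ) :
    Submodule ℂ (Fin d → JetSpace n p k) where
  carrier := {a | (∀ i, a i ∈ basicJets (W i) p k m) ∧ ∑ i, a i = 0}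
  zero_mem' := ⟨fun i => (basicJets (W i) p k m).zero_mem, by simp⟩
  add_mem' := by
    rintro σ τ ⟨h1, h2⟩ ⟨h3, h4⟩
    exact ⟨fun i => (basicJets (W i) p k m).add_mem (h1 i) (h3 i), by
      simp only [Pi.add_apply, Finset.sum_add_distrib]
      rw [h2, h4, add_zero]⟩
  smul_mem' := by
    rintro a σ ⟨h1, h2⟩
    exact ⟨fun i => (basicJets (W i) p k m).smul_mem a (h1 i), by
      simp only [Pi.smul_apply, ← Finset.smul_sum]
      rw [h2, smul_zero]⟩

/-- The family of subspaces `R x ⊆ V` (`x ∈ U`) is a holomorphic vector bundle of rank `r` over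
`U`, as a holomorphic subbundle of the trivial bundle `U × V`: near each point of `U` it has a
holomorphic frame consisting of `r` sections. -/
def IsHolomorphicSubbundle {V : Type*} [NormedAddCommGroup V] [NormedSpace ℂ V]
    (U : Set (Fin n → ℂ)) (R : (Fin n → ℂ) → Submodule ℂ V) (r : ℕ) : Prop :=
  ∀ m ∈ U, ∃ s : Fin r → (Fin n → ℂ) → V, ∀ᶠ x in 𝓝 m,
    (∀ j, AnalyticAt ℂ (s j) x) ∧ LinearIndependent ℂ (fun j => s j x) ∧
      Submodule.span ℂ (Set.range fun j => s j x) = R x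

/-! ### The matrices `P_k` and ordinary webs -/

/-- The set `S(r,h)` of multi-indices of order `h` in `r` variables. -/
abbrev MultiIndex (r h : ℕ) : Type :=
  {L : Fin r →₀ ℕ // L ∈ (Finset.univ : Finset (Fin r)).finsuppAntidiag h}

/-- The set of the multi-indices `1 ≤ α_1 < ⋯ < α_p ≤ r`. -/
abbrev Increasing (p r : ℕ) : Type := Fin p ↪o Fin r

/-- The Jacobian matrix `((u_α)'_λ)` of `u` at `m`. -/
noncomputable def jacobian (u : (Fin n → ℂ) → (Fin q → ℂ)) (m : Fin n → ℂ) :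
    Matrix (Fin q) (Fin n) ℂ :=
  Matrix.of fun α l => fderiv ℂ u m (Pi.single l 1) α

/-- The coefficient `N_L^K` (for `|L| = |K|`) attached to the Jacobian matrix `D`: the sum of the
products `(u_{α_1})'_{λ_1} ⋯ (u_{α_s})'_{λ_s}`, where `(λ_1, …, λ_s)` is a fixed sequence in which
each `λ` occurs `L λ` times and `(α_1, …, α_s)` runs over the sequences in which each `α` occurs
`K α` times.  Equivalently, the coefficient of `X^K` in `∏_λ (∑_α (u_α)'_λ X_α)^{L λ}`.
See `coeffN_zero` and `coeffN_add_single` for the recursion that it satisfies. -/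
noncomputable def coeffN (D : Matrix (Fin q) (Fin n) ℂ) (L : Fin n →₀ ℕ) (K : Fin q →₀ ℕ) : ℂ :=
  MvPolynomial.coeff K
    (∏ l : Fin n, (∑ α : Fin q, MvPolynomial.C (D α l) * MvPolynomial.X α) ^ L l)

theorem coeffN_zero (D : Matrix (Fin q) (Fin n) ℂ) : coeffN D 0 0 = 1 := by
  simp [coeffN]

/-- `N_{L + 1_λ}^K = ∑_α N_L^{K - 1_α} (u_α)'_λ`, the sum being over the `α` with `K α > 0`. -/
theorem coeffN_add_single (D : Matrix (Fin q) (Fin n) ℂ) (L : Fin n →₀ ℕ) (l : Fin n)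
    (K : Fin q →₀ ℕ) :
    coeffN D (L + Finsupp.single l 1) K =
      ∑ α ∈ Finset.univ.filter (fun α => 0 < K α),
        coeffN D L (K - Finsupp.single α 1) * D α l := by
  classical
  have h : (∏ i : Fin n, (∑ α : Fin q, MvPolynomial.C (D α i) * MvPolynomial.X α) ^
      ((L + Finsupp.single l 1 : Fin n →₀ ℕ) i) : MvPolynomial (Fin q) ℂ) =
      ∑ α : Fin q, MvPolynomial.C (D α l) *
        ((∏ i : Fin n, (∑ α : Fin q, MvPolynomial.C (D α i) * MvPolynomial.X α) ^ L i)
          * MvPolynomial.X α) := by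
    simp only [Finsupp.add_apply, pow_add, Finset.prod_mul_distrib]
    rw [Finset.prod_eq_single (a := l) (f := fun i =>
      (∑ α : Fin q, MvPolynomial.C (D α i) * MvPolynomial.X α : MvPolynomial (Fin q) ℂ) ^
        ((Finsupp.single l 1 : Fin n →₀ ℕ) i)) (fun i _ hi => by simp [Finsupp.single_eq_of_ne hi]) (by simp)]
    simp only [Finsupp.single_eq_same, pow_one, Finset.mul_sum]
    exact Finset.sum_congr rfl fun α _ => by ring
  rw [coeffN, h, MvPolynomial.coeff_sum, Finset.sum_filter]
  refine Finset.sum_congr rfl fun α _ => ?_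
  rw [MvPolynomial.coeff_C_mul, MvPolynomial.coeff_mul_X']
  by_cases hK : K α = 0
  · simp [hK]
  · simp [hK, Nat.pos_of_ne_zero hK, coeffN, mul_comm]

/-- The minor `J_B^A` of the Jacobian matrix `D`, with rows in `A` and columns in `B`. -/
noncomputable def minor {p : ℕ} (D : Matrix (Fin q) (Fin n) ℂ) (A : Increasing p q)
    (B : Increasing p n) : ℂ :=
  (D.submatrix A B).det

/-- The matrix `P_k(p)` attached to the Jacobian matrices `D_i` of the generating systems `u_i`:
its entry at `((B,L),(i,A,K))`, with `|L| = |K| = k`, is `M_{B,L}^{i,A,K} = J_{i,B}^A N_L^K`. -/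
noncomputable def matrixP (D : Fin d → Matrix (Fin q) (Fin n) ℂ) (p k : ℕ) :
    Matrix (Increasing p n × MultiIndex n k) (Fin d × Increasing p q × MultiIndex q k) ℂ :=
  Matrix.of fun r s => minor (D s.1) s.2.1 r.1 * coeffN (D s.1) r.2.1 s.2.2.1

/-- The web is `p`-ordinary: at each point `m` of `U`, for generating systems `u_i` of functions
basic for the foliations of the web near `m`, all the matrices `P_k` (`k ≥ 0`) have the maximal
rank `inf (b(n,p) c(n,k), d b(q,p) c(q,k))`. (The rank does not depend on the choice of the
generating systems.) -/
def IsOrdinary (W : Web n q d U) (p : ℕ) : Prop :=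
  ∀ m ∈ U, ∃ u : Fin d → (Fin n → ℂ) → (Fin q → ℂ),
    (∀ i, IsGeneratingSystem (W i) m (u i)) ∧
      ∀ k : ℕ, (matrixP (fun i => jacobian (u i) m) p k).rank =
        min (b n p * c n k) (d * b q p * c q k)

end OrdinaryWeb

/-!
Near a point `m`, a foliation of codimension `q` is given by a submersion `u` to `ℂ^q`, and its
basic `p`-forms are exactly the pullbacks `u^* η` of analytic `p`-forms on `ℂ^q`
(`IsBasicNear.exists_eq_pullback`, `IsDefining.isBasicNear_pullback`). So an abelian relation is a
family `(η_i)` of analytic forms on `ℂ^q` with `∑ u_i^* η_i = 0`, and everything reduces to the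
order-by-order study of the map `(η_i) ↦ ∑ u_i^* η_i`.

The matrices `P_h` are the leading terms of this map. With the divided powers `y^K / K!`, the
homogeneous part of degree `h` at `m` of the pullback by `u_i` of `(y - u_i(m))^K / K! dy_A`,
`|K| = h`, is the linear combination of the forms `(z - m)^L / L! dx_B` given by the column
`(i, A, K)` of `P_h` (`mono_mulVec`, `pullback_elemForm_isBigO`). Orders of vanishing are written
throughout as `ω = O(‖z - m‖ ^ k)`, which for analytic `ω` says that the jet of order `k - 1` is
zero (`jet_eq_zero_iff`).

Put `ρ_h = b(n,p) c(n,h) / (b(q,p) c(q,h))`, which is nondecreasing in `h` (`ratio_mono`); thus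
`P_h` has at least as many columns as rows exactly for `h ≤ k_p^0`.

* For `h ≤ k_p^0`, ordinarity says that `P_h` is onto. Correcting degree by degree, every jet of
  order `k ≤ k_p^0` of analytic forms at `m` is a sum of basic jets
  (`exists_sum_pullback_isBigO`). The formal relations of order `k` near `m` are therefore the
  kernels of an analytic family of surjections onto a fixed space of jets; such kernels have an
  analytic frame (`exists_analytic_frame`, `exists_frame_formalRelations`), and their dimension is
  the difference of the numbers of columns and rows of `P_0, …, P_k`.
* For `h > k_p^0`, ordinarity says that `P_h` is injective. Hence an abelian relation whose jet of
  order `k_p^0` is zero vanishes to infinite order (`isBigO_of_sum_pullback_eq_zero`), so it is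
  zero: the space of abelian relations at `m` embeds in the fibre at `m` of `R_k^p`, `k = k_p^0`
  (`jetRelation_injective`). The rank of that bundle is `π_p^0(n,d,q)`, since precisely the terms
  with `h ≤ k_p^0` contribute to the latter (`rankBound_eq_jetRank`).
-/

namespace OrdinaryWeb

/-! ### Coordinates on covectors and multi-indices -/

/-- The covector `dx_B = dx_{B 1} ∧ ⋯ ∧ dx_{B p}` on `ℂ^r`. -/
noncomputable def covBasis {p r : ℕ} (B : Increasing p r) : Cov r p :=
  ContinuousAlternatingMap.compContinuousLinearMap
    { toMultilinearMap := (Matrix.detRowAlternating (R := ℂ) (n := Fin p)).toMultilinearMap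
      map_eq_zero_of_eq' := (Matrix.detRowAlternating (R := ℂ) (n := Fin p)).map_eq_zero_of_eq'
      cont := Continuous.matrix_det (A := fun M : Fin p → Fin p → ℂ => Matrix.of M) continuous_id }
    (ContinuousLinearMap.pi fun s => ContinuousLinearMap.proj (B s))

theorem covBasis_apply {p r : ℕ} (B : Increasing p r) (w : Fin p → Fin r → ℂ) :
    covBasis B w = (Matrix.of fun s t => w s (B t)).det := rfl

theorem covBasis_single {p r : ℕ} (A B : Increasing p r) :
    covBasis A (fun s => Pi.single (B s) 1) = if A = B then 1 else 0 := by
  rw [covBasis_apply]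
  split_ifs with h
  · subst h
    rw [← Matrix.det_one (n := Fin p)]
    congr 1
    ext s t
    simp [Matrix.one_apply, Pi.single_apply, eq_comm]
  · -- distinct increasing families have distinct ranges, so some row vanishes
    have hr : ∃ s, B s ∉ Set.range A := by
      by_contra! hc
      apply h
      have hsub : Set.range B ⊆ Set.range A := by rintro _ ⟨s, rfl⟩; exact hc s
      have heq : Set.range B = Set.range A := by
        refine Set.eq_of_subset_of_ncard_le hsub ?_
        rw [← Set.image_univ, ← Set.image_univ, Set.ncard_image_of_injective _ A.injective,
          Set.ncard_image_of_injective _ B.injective]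
      apply RelEmbedding.coe_fn_injective
      exact ((StrictMono.range_inj B.strictMono A.strictMono).1 heq).symm
    obtain ⟨s, hs⟩ := hr
    refine Matrix.det_eq_zero_of_row_eq_zero s fun t => ?_
    have : A t ≠ B s := fun e => hs ⟨t, e⟩
    simp [Pi.single_apply, this]

/-- A covector is determined by its values on increasing families of basis vectors. -/
theorem cov_ext {p r : ℕ} {η ζ : Cov r p}
    (h : ∀ B : Increasing p r, η (fun s => Pi.single (B s) 1) = ζ (fun s => Pi.single (B s) 1)) :
    η = ζ := by
  apply ContinuousAlternatingMap.toAlternatingMap_injective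
  refine Module.Basis.ext_alternating (Pi.basisFun ℂ (Fin r)) fun v hv => ?_
  -- sort the injective family `v`
  let σ := Tuple.sort v
  have hm : StrictMono (v ∘ σ) :=
    (Tuple.monotone_sort v).strictMono_of_injective (hv.comp σ.injective)
  have e := h (OrderEmbedding.ofStrictMono (v ∘ σ) hm)
  have key : ∀ θ : Cov r p, θ (fun s => Pi.single (OrderEmbedding.ofStrictMono (v ∘ σ) hm s) 1) =
      Equiv.Perm.sign σ • θ.toAlternatingMap (fun s => Pi.basisFun ℂ (Fin r) (v s)) := fun θ => by
    rw [← AlternatingMap.map_perm]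
    simp [Function.comp_def]
  rw [key, key] at e
  exact smul_left_cancel _ e

theorem cov_eq_sum {p r : ℕ} (η : Cov r p) :
    η = ∑ B : Increasing p r, η (fun s => Pi.single (B s) 1) • covBasis B := by
  refine cov_ext fun A => ?_
  rw [ContinuousAlternatingMap.sum_apply]
  simp [covBasis_single]

theorem covBasis_coeff {p r : ℕ} (c : Increasing p r → ℂ) (B : Increasing p r) :
    (∑ A, c A • covBasis A : Cov r p) (fun s => Pi.single (B s) 1) = c B := by
  rw [ContinuousAlternatingMap.sum_apply]
  simp [covBasis_single]

instance (r p : ℕ) : FiniteDimensional ℂ (Cov r p) :=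
  Module.Finite.of_surjective
    (∑ B : Increasing p r, (LinearMap.proj B : (Increasing p r → ℂ) →ₗ[ℂ] ℂ).smulRight (covBasis B))
    fun η => ⟨_, by simpa using (cov_eq_sum η).symm⟩

theorem card_increasing (p r : ℕ) : Fintype.card (Increasing p r) = b r p := by
  rw [Fintype.card_congr (Set.powersetCard.ofFinEmbEquiv (n := p) (I := Fin r)),
    ← Nat.card_eq_fintype_card, Set.powersetCard.card]
  simp

theorem card_multiIndex (r h : ℕ) (hr : 1 ≤ r) : Fintype.card (MultiIndex r h) = c r h := by
  rw [Fintype.card_coe, Finset.card_finsuppAntidiag_nat_eq_choose]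
  simp only [Finset.card_univ, Fintype.card_fin, c, b]
  congr 1
  omega

theorem MultiIndex.sum_eq {r h : ℕ} (K : MultiIndex r h) : ∑ a, K.1 a = h :=
  (Finset.mem_finsuppAntidiag.1 K.2).1

/-- The divided power monomial `y^K / K!`. -/
noncomputable def mono {r : ℕ} (K : Fin r →₀ ℕ) (y : Fin r → ℂ) : ℂ :=
  ∏ a, y a ^ K a / (K a).factorial

/-- The multinomial theorem in divided power form. -/
theorem sum_pow_eq_sum_mono {R : Type*} [CommRing R] [Algebra ℂ R] {r : ℕ} (h : ℕ)
    (f : Fin r → R) :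
    (∑ a, f a) ^ h = (h.factorial : ℂ) • ∑ K : MultiIndex r h,
      (∏ a, ((K.1 a).factorial : ℂ))⁻¹ • ∏ a, f a ^ K.1 a := by
  classical
  rw [Finset.sum_pow_eq_sum_piAntidiag, Finset.smul_sum]
  refine Finset.sum_bij' (fun k hk => ⟨Finsupp.equivFunOnFinite.symm k, ?_⟩)
    (fun K _ => K.1) ?_ ?_ ?_ ?_ ?_
  · rw [Finset.mem_piAntidiag] at hk
    simpa [Finset.mem_finsuppAntidiag] using hk.1
  · intros; simp
  · intro K _
    have := MultiIndex.sum_eq K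
    simpa [Finset.mem_piAntidiag] using this
  · intros; rfl
  · intro K _; ext; rfl
  · intro k hk
    have hs := (Finset.mem_piAntidiag.1 hk).1
    have hm := Nat.multinomial_spec Finset.univ k
    rw [hs] at hm
    have hne : (∏ a, ((k a).factorial : ℂ)) ≠ 0 :=
      Finset.prod_ne_zero_iff.2 fun a _ => by exact_mod_cast (k a).factorial_ne_zero
    have e : (Nat.multinomial Finset.univ k : ℂ) =
        (h.factorial : ℂ) * (∏ a, ((k a).factorial : ℂ))⁻¹ := by
      rw [eq_mul_inv_iff_mul_eq₀ hne, mul_comm]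
      exact_mod_cast hm
    rw [smul_smul]
    simp only [Finsupp.equivFunOnFinite_symm_apply_apply]
    rw [← e, Algebra.smul_def, map_natCast]

/-- A linear substitution in a divided power monomial: the coefficients are the `N_L^K`. -/
theorem mono_mulVec {n q h : ℕ} (D : Matrix (Fin q) (Fin n) ℂ) (y : Fin n → ℂ)
    (K : MultiIndex q h) :
    mono K.1 (D.mulVec y) = ∑ L : MultiIndex n h, coeffN D L.1 K.1 * mono L.1 y := by
  classical
  -- expand `(∑_α ∑_l X_α D_{α l} y_l)^h` in the two possible ways and compare the
  -- coefficients of `X^K`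
  let X : Fin q → MvPolynomial (Fin q) ℂ := MvPolynomial.X
  have e1 := sum_pow_eq_sum_mono h fun α => X α * MvPolynomial.C (D.mulVec y α)
  have e2 := sum_pow_eq_sum_mono h fun l : Fin n =>
    MvPolynomial.C (y l) * ∑ α, MvPolynomial.C (D α l) * X α
  have e3 : ∑ α, X α * MvPolynomial.C (D.mulVec y α) =
      ∑ l : Fin n, MvPolynomial.C (y l) * ∑ α, MvPolynomial.C (D α l) * X α := by
    simp only [Matrix.mulVec, dotProduct, map_sum, map_mul, Finset.mul_sum]
    rw [Finset.sum_comm]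
    refine Finset.sum_congr rfl fun l _ => Finset.sum_congr rfl fun α _ => by ring
  rw [e3] at e1
  have e4 := e1.symm.trans e2
  have hh : (h.factorial : ℂ) ≠ 0 := by exact_mod_cast h.factorial_ne_zero
  have e5 := congrArg (MvPolynomial.coeff K.1) (smul_right_injective _ hh e4)
  simp only [MvPolynomial.coeff_sum, MvPolynomial.coeff_smul, mul_pow, Finset.prod_mul_distrib,
    ← MvPolynomial.C_pow] at e5
  simp only [← map_prod, MvPolynomial.coeff_C_mul] at e5
  have e6 : ∀ K' : MultiIndex q h, MvPolynomial.coeff K.1 ((∏ a, X a ^ K'.1 a) *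
      MvPolynomial.C (∏ a, (D.mulVec y a) ^ K'.1 a)) =
        if K' = K then ∏ a, (D.mulVec y a) ^ K.1 a else 0 := fun K' => by
    rw [mul_comm, MvPolynomial.coeff_C_mul]
    have : (∏ a, X a ^ K'.1 a) = MvPolynomial.monomial K'.1 (1 : ℂ) := by
      rw [MvPolynomial.monomial_eq, Finsupp.prod_fintype _ _ (by simp)]; simp [X]
    rw [this, MvPolynomial.coeff_monomial]
    by_cases hK : K' = K
    · subst hK; simp
    · simp [hK, Subtype.ext_iff.not.1 hK]
  simp only [e6] at e5
  simp only [smul_eq_mul, mul_ite, mul_zero, Finset.sum_ite_eq', Finset.mem_univ, if_true] at e5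
  simp only [mono, div_eq_mul_inv, Finset.prod_mul_distrib, Finset.prod_inv_distrib]
  rw [mul_comm, e5]
  refine Finset.sum_congr rfl fun L _ => ?_
  simp only [coeffN, X]
  ring

/-! ### Jets and orders of vanishing -/

section Jets

theorem isBigO_sub_iff {E G : Type*} [NormedAddCommGroup E] [NormedAddCommGroup G] {f : E → G}
    {x : E} {k : ℕ} :
    (fun y => f (x + y)) =O[𝓝 0] (fun y => ‖y‖ ^ k) ↔ f =O[𝓝 x] fun z => ‖z - x‖ ^ k := by
  constructor
  · intro h
    have ht : Filter.Tendsto (fun z : E => z - x) (𝓝 x) (𝓝 0) := by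
      have : Continuous fun z : E => z - x := by fun_prop
      simpa using this.tendsto x
    simpa [Function.comp_def] using h.comp_tendsto ht
  · intro h
    have ht : Filter.Tendsto (fun y : E => x + y) (𝓝 0) (𝓝 x) := by
      have : Continuous fun y : E => x + y := by fun_prop
      simpa using this.tendsto 0
    simpa [Function.comp_def] using h.comp_tendsto ht

theorem isBigO_pow_of_le {E : Type*} [NormedAddCommGroup E] {x : E} {j k : ℕ} (h : j ≤ k) :
    (fun z : E => ‖z - x‖ ^ k) =O[𝓝 x] fun z => ‖z - x‖ ^ j := by
  refine Asymptotics.IsBigO.of_bound 1 ?_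
  filter_upwards [Metric.ball_mem_nhds x one_pos] with z hz
  have hz1 : ‖z - x‖ ≤ 1 := by rw [← dist_eq_norm]; exact (Metric.mem_ball.1 hz).le
  simpa using pow_le_pow_of_le_one (norm_nonneg _) hz1 h

variable {E F : Type*} [NormedAddCommGroup E] [NormedSpace ℂ E]
  [NormedAddCommGroup F] [NormedSpace ℂ F]

/-- If `f` vanishes to order `k` at `x`, so do the homogeneous terms of its power series of
degree less than `k`. -/
theorem powerSeries_apply_eq_zero_of_isBigO {f : E → F} {x : E} {k : ℕ}
    {p : FormalMultilinearSeries ℂ E F} (hp : HasFPowerSeriesAt f p x)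
    (h : f =O[𝓝 x] fun z => ‖z - x‖ ^ k) :
    ∀ j < k, ∀ y, (p j fun _ => y) = 0 := by
  intro j
  induction j using Nat.strong_induction_on with
  | _ j ih =>
    intro hj
    have psum : p.partialSum (j + 1) = fun y => p j fun _ => y := by
      funext z
      refine Finset.sum_eq_single _ (fun b hb hnb => ?_) (by simp)
      have := Finset.mem_range_succ_iff.mp hb
      exact ih b (this.lt_of_ne hnb) (by omega) z
    have h1 := hp.isBigO_sub_partialSum_pow (j + 1)
    rw [psum] at h1
    have h2 := isBigO_sub_iff.2 (h.trans (isBigO_pow_of_le (Nat.succ_le_of_lt hj)))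
    have h3 := h2.sub h1
    simp only [sub_sub_cancel] at h3
    exact h3.continuousMultilinearMap_apply_eq_zero

/-- The jet of order `k` of an analytic map at `x` vanishes iff the map vanishes at `x` to
order `k + 1`. -/
theorem iteratedFDeriv_eq_zero_iff_isBigO [CompleteSpace F] {f : E → F} {x : E}
    (hf : AnalyticAt ℂ f x) (k : ℕ) :
    (∀ j ≤ k, iteratedFDeriv ℂ j f x = 0) ↔ f =O[𝓝 x] fun z => ‖z - x‖ ^ (k + 1) := by
  obtain ⟨p, r, hp⟩ := hf
  constructor
  · intro h
    have h0 : p.partialSum (k + 1) = 0 := by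
      funext y
      refine Finset.sum_eq_zero fun j hj => ?_
      have e := hp.factorial_smul y j
      rw [h j (Finset.mem_range_succ_iff.mp hj), zero_apply, ← Nat.cast_smul_eq_nsmul ℂ] at e
      exact (smul_eq_zero.1 e).resolve_left (by exact_mod_cast j.factorial_ne_zero)
    have h1 := hp.hasFPowerSeriesAt.isBigO_sub_partialSum_pow (k + 1)
    simp only [h0, Pi.zero_apply, sub_zero] at h1
    exact isBigO_sub_iff.1 h1
  · intro h j hj
    have h0 := powerSeries_apply_eq_zero_of_isBigO hp.hasFPowerSeriesAt h j (Nat.lt_succ_of_le hj)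
    ext v
    rw [hp.iteratedFDeriv_eq_sum_of_completeSpace,
      ← ContinuousMultilinearMap.iteratedFDeriv_comp_diagonal _ 0]
    simp [h0]

/-- An analytic map which vanishes to infinite order at `x` vanishes near `x`. -/
theorem eventually_eq_zero_of_forall_isBigO {f : E → F} {x : E}
    (hf : AnalyticAt ℂ f x) (h : ∀ k : ℕ, f =O[𝓝 x] fun z => ‖z - x‖ ^ k) :
    ∀ᶠ z in 𝓝 x, f z = 0 := by
  obtain ⟨p, hp⟩ := hf
  have h0 : ∀ j y, (p j fun _ => y) = 0 := fun j =>
    powerSeries_apply_eq_zero_of_isBigO hp (h (j + 1)) j (Nat.lt_succ_self j)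
  filter_upwards [hp.eventually_hasSum_sub] with z hz
  simp only [h0] at hz
  exact hz.unique hasSum_zero

end Jets

/-! ### Taylor expansion in divided power monomials -/

/-- The multi-indices of order at most `k` in `r` variables. -/
abbrev MultiIndexLE (r k : ℕ) : Type := Σ h : Fin (k + 1), MultiIndex r h

/-- The divided power monomials of degree at most `k` span the polynomial functions of degree at
most `k`. -/
theorem exists_eval_eq_sum_mono {r k : ℕ} (P : MvPolynomial (Fin r) ℂ) (hP : P.totalDegree ≤ k) :
    ∃ c : MultiIndexLE r k → ℂ, ∀ y, MvPolynomial.eval y P = ∑ ι, c ι * mono ι.2.1 y := by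
  classical
  refine ⟨fun ι => MvPolynomial.coeff ι.2.1 P * ∏ a, ((ι.2.1 a).factorial : ℂ), fun y => ?_⟩
  rw [MvPolynomial.eval_eq']
  have hne : ∀ K : Fin r →₀ ℕ, (∏ a, ((K a).factorial : ℂ)) ≠ 0 := fun K =>
    Finset.prod_ne_zero_iff.2 fun a _ => by exact_mod_cast (K a).factorial_ne_zero
  have hd : ∀ K : Fin r →₀ ℕ, K ∈ P.support → ∑ a, K a ≤ k := fun K hK => by
    have := (MvPolynomial.le_totalDegree hK).trans hP
    rwa [Finsupp.sum_fintype _ _ (by simp)] at this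
  have e : ∀ ι : MultiIndexLE r k, MvPolynomial.coeff ι.2.1 P * (∏ a, ((ι.2.1 a).factorial : ℂ)) *
      mono ι.2.1 y = MvPolynomial.coeff ι.2.1 P * ∏ a, y a ^ ι.2.1 a := fun ι => by
    rw [mono, Finset.prod_div_distrib, mul_assoc, mul_div_cancel₀ _ (hne _)]
  simp only [e]
  refine Finset.sum_bij_ne_zero (fun K hK _ => ⟨⟨∑ a, K a, Nat.lt_succ_of_le (hd K hK)⟩,
    ⟨K, by simp [Finset.mem_finsuppAntidiag]⟩⟩) (by simp) ?_ ?_ (by simp)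
  · intro K _ _ K' _ _ h
    simp only [Sigma.mk.injEq, Fin.mk.injEq] at h
    obtain ⟨h1, h2⟩ := h
    have : ∀ {s t : ℕ} (hst : s = t) (A : MultiIndex r s) (B : MultiIndex r t),
        A ≍ B → A.1 = B.1 := by
      rintro s t rfl A B h; rw [eq_of_heq h]
    exact this h1 _ _ h2
  · rintro ⟨⟨h, hh⟩, ⟨K, hK⟩⟩ - hne0
    have hs : ∑ a, K a = h := (Finset.mem_finsuppAntidiag.1 hK).1
    subst hs
    refine ⟨K, ?_, hne0, rfl⟩
    rw [MvPolynomial.mem_support_iff]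
    exact left_ne_zero_of_mul hne0

/-- Taylor expansion of order `k` at `y₀`, written in powers of `y - y₁`. -/
theorem exists_taylor {F : Type*} [NormedAddCommGroup F] [NormedSpace ℂ F] {r : ℕ}
    {f : (Fin r → ℂ) → F} {y₀ : Fin r → ℂ} (hf : AnalyticAt ℂ f y₀) (y₁ : Fin r → ℂ) (k : ℕ) :
    ∃ c : MultiIndexLE r k → F,
      (fun y => f y - ∑ ι, mono ι.2.1 (y - y₁) • c ι) =O[𝓝 y₀] fun y => ‖y - y₀‖ ^ (k + 1) := by
  obtain ⟨p, hp⟩ := hf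
  have key : ∀ (j : ℕ) (_ : j ≤ k) (g : Fin j → Fin r), ∃ c : MultiIndexLE r k → ℂ,
      ∀ y : Fin r → ℂ, ∏ i, (y - y₀) (g i) = ∑ ι, c ι * mono ι.2.1 (y - y₁) := by
    intro j hj g
    obtain ⟨c, hc⟩ := exists_eval_eq_sum_mono (k := k)
      (∏ i, (MvPolynomial.X (g i) + MvPolynomial.C ((y₁ - y₀) (g i))) : MvPolynomial (Fin r) ℂ) (by
        refine (MvPolynomial.totalDegree_finsetProd _ _).trans ?_
        refine (Finset.sum_le_card_nsmul _ _ 1 fun i _ => ?_).trans (by simpa using hj)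
        refine (MvPolynomial.totalDegree_add _ _).trans ?_
        rw [MvPolynomial.totalDegree_C, MvPolynomial.totalDegree_X]
        simp)
    refine ⟨c, fun y => ?_⟩
    rw [← hc, map_prod]
    refine Finset.prod_congr rfl fun i _ => ?_
    simp
  choose c hc using key
  have hsum : ∀ y, p.partialSum (k + 1) (y - y₀) = ∑ ι, mono ι.2.1 (y - y₁) •
      ∑ j : Fin (k + 1), ∑ g : Fin j → Fin r,
        c j (Nat.lt_succ_iff.1 j.2) g ι • p j (fun i => Pi.single (g i) 1) := by
    intro y
    rw [FormalMultilinearSeries.partialSum, Finset.sum_range]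
    simp only [Finset.smul_sum]
    rw [Finset.sum_comm]
    refine Finset.sum_congr rfl fun j _ => ?_
    rw [Finset.sum_comm]
    conv_lhs => rw [pi_eq_sum_univ' (y - y₀)]
    rw [ContinuousMultilinearMap.map_sum]
    refine Finset.sum_congr rfl fun g _ => ?_
    rw [ContinuousMultilinearMap.map_smul_univ, hc j (Nat.lt_succ_iff.1 j.2), Finset.sum_smul]
    refine Finset.sum_congr rfl fun ι _ => ?_
    rw [smul_smul, mul_comm]
  refine ⟨fun ι => ∑ j : Fin (k + 1), ∑ g : Fin j → Fin r,
    c j (Nat.lt_succ_iff.1 j.2) g ι • p j (fun i => Pi.single (g i) 1), ?_⟩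
  simp only [← hsum]
  refine isBigO_sub_iff.1 ?_
  simpa using hp.isBigO_sub_partialSum_pow (k + 1)

/-- A polynomial in one variable of degree at most `k` which vanishes to order `k + 1` is zero. -/
theorem polynomial_eq_zero_of_isBigO {Q : Polynomial ℂ} {k : ℕ} (hQ : Q.natDegree ≤ k)
    (h : (fun t => Q.eval t) =O[𝓝 0] fun t : ℂ => ‖t‖ ^ (k + 1)) : Q = 0 := by
  by_contra h0
  obtain ⟨R, hR, hdvd⟩ := Polynomial.exists_eq_pow_rootMultiplicity_mul_and_not_dvd Q h0 0
  set m := Q.rootMultiplicity 0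
  have hm : m ≤ k := by
    refine le_trans ?_ hQ
    rw [show m = Q.rootMultiplicity 0 from rfl, ← Polynomial.count_roots]
    exact (Multiset.count_le_card _ _).trans (Polynomial.card_roots' Q)
  have hR0 : R.eval 0 ≠ 0 := Polynomial.dvd_iff_isRoot.not.1 hdvd
  apply hR0
  obtain ⟨C, hC⟩ := h.bound
  have hlim : Filter.Tendsto (fun t => ‖R.eval t‖) (𝓝[≠] 0) (𝓝 ‖R.eval 0‖) :=
    (R.continuous.norm.tendsto 0).mono_left nhdsWithin_le_nhds
  have hlim2 : Filter.Tendsto (fun t : ℂ => C * ‖t‖) (𝓝[≠] 0) (𝓝 0) := by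
    have : Continuous fun t : ℂ => C * ‖t‖ := by fun_prop
    have := (this.tendsto 0).mono_left (nhdsWithin_le_nhds (s := {0}ᶜ))
    simpa using this
  have hle : ∀ᶠ t : ℂ in 𝓝[≠] 0, ‖R.eval t‖ ≤ C * ‖t‖ := by
    filter_upwards [nhdsWithin_le_nhds hC, self_mem_nhdsWithin,
      nhdsWithin_le_nhds (Metric.ball_mem_nhds (0 : ℂ) one_pos)] with t ht ht0 ht1
    have ht1' : ‖t‖ ≤ 1 := by simpa using le_of_lt (by simpa using ht1)
    have hpos : 0 < ‖t‖ := norm_pos_iff.2 ht0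
    rw [hR] at ht
    simp only [Polynomial.eval_mul, Polynomial.eval_pow, map_zero, sub_zero, Polynomial.eval_X,
      norm_mul, norm_pow, norm_norm] at ht
    have hCnn : 0 ≤ C := by
      by_contra hneg
      have := mul_neg_of_neg_of_pos (not_le.1 hneg) (pow_pos hpos (k + 1))
      have : 0 ≤ ‖t‖ ^ m * ‖R.eval t‖ := by positivity
      linarith
    have h3 : ‖t‖ ^ (k + 1) ≤ ‖t‖ ^ m * ‖t‖ := by
      rw [← pow_succ]
      exact pow_le_pow_of_le_one hpos.le ht1' (by omega)
    have h4 := ht.trans (mul_le_mul_of_nonneg_left h3 hCnn)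
    have h5 : ‖t‖ ^ m * ‖R.eval t‖ ≤ ‖t‖ ^ m * (C * ‖t‖) := by linarith [h4]
    exact le_of_mul_le_mul_left h5 (pow_pos hpos m)
  have := le_of_tendsto_of_tendsto hlim hlim2 hle
  exact norm_le_zero_iff.1 this

/-- A polynomial map of degree at most `k` which vanishes to order `k + 1` at some point is
zero. -/
theorem coeff_eq_zero_of_isBigO {F : Type*} [NormedAddCommGroup F] [NormedSpace ℂ F] {r k : ℕ}
    {y₀ y₁ : Fin r → ℂ} {c : MultiIndexLE r k → F}
    (h : (fun y => ∑ ι, mono ι.2.1 (y - y₁) • c ι) =O[𝓝 y₀] fun y => ‖y - y₀‖ ^ (k + 1)) :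
    c = 0 := by
  classical
  have scalar : ∀ c : MultiIndexLE r k → ℂ, (fun y => ∑ ι, c ι * mono ι.2.1 (y - y₁)) =O[𝓝 y₀]
      (fun y => ‖y - y₀‖ ^ (k + 1)) → c = 0 := by
    intro c h
    -- along each line through `y₀` the function is a polynomial of degree at most `k`
    have hzero : ∀ w : Fin r → ℂ, ∑ ι, c ι * mono ι.2.1 (y₀ + w - y₁) = 0 := by
      intro w
      let Q : Polynomial ℂ := ∑ ι : MultiIndexLE r k, Polynomial.C (c ι) * ∏ a,
        (Polynomial.C (y₀ a - y₁ a) + Polynomial.C (w a) * Polynomial.X) ^ ι.2.1 a *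
          Polynomial.C (((ι.2.1 a).factorial : ℂ)⁻¹)
      have hev : ∀ t, Q.eval t = ∑ ι, c ι * mono ι.2.1 (y₀ + t • w - y₁) := fun t => by
        simp only [Q, Polynomial.eval_finsetSum, Polynomial.eval_mul, Polynomial.eval_C,
          Polynomial.eval_prod, Polynomial.eval_pow, Polynomial.eval_add, Polynomial.eval_X, mono,
          Pi.sub_apply, Pi.add_apply, Pi.smul_apply, smul_eq_mul, div_eq_mul_inv]
        refine Finset.sum_congr rfl fun ι _ => ?_
        congr 1
        refine Finset.prod_congr rfl fun a _ => ?_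
        congr 2
        ring
      have hdeg : Q.natDegree ≤ k := by
        refine Polynomial.natDegree_sum_le_of_forall_le _ _ fun ι _ => ?_
        refine (Polynomial.natDegree_C_mul_le _ _).trans ?_
        refine (Polynomial.natDegree_prod_le _ _).trans ?_
        refine le_trans (Finset.sum_le_sum fun a _ => ?_) ((MultiIndex.sum_eq ι.2).le.trans
          (Nat.lt_succ_iff.1 ι.1.2))
        refine (Polynomial.natDegree_mul_C_le _ _).trans ?_
        refine Polynomial.natDegree_pow_le.trans ?_
        have : (Polynomial.C (y₀ a - y₁ a) + Polynomial.C (w a) * Polynomial.X).natDegree ≤ 1 := by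
          compute_degree
        nlinarith
      have hO : (fun t => Q.eval t) =O[𝓝 0] fun t : ℂ => ‖t‖ ^ (k + 1) := by
        have ht : Filter.Tendsto (fun t : ℂ => y₀ + t • w) (𝓝 0) (𝓝 y₀) := by
          have : Continuous fun t : ℂ => y₀ + t • w := by fun_prop
          simpa using this.tendsto 0
        have h2 := h.comp_tendsto ht
        simp only [Function.comp_def, add_sub_cancel_left, ← hev] at h2
        refine h2.trans (Asymptotics.IsBigO.pow ?_ _)
        simp only [norm_smul]
        exact (Asymptotics.isBigO_refl (fun t : ℂ => ‖t‖) _).mul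
          (Asymptotics.isBigO_const_const _ one_ne_zero _) |>.trans
            (by simpa using Asymptotics.isBigO_refl _ _)
      have h0 := polynomial_eq_zero_of_isBigO hdeg hO
      have := hev 1
      rw [h0, one_smul] at this
      simpa using this.symm
    let P : MvPolynomial (Fin r) ℂ := ∑ ι : MultiIndexLE r k,
      MvPolynomial.monomial ι.2.1 (c ι * (∏ a, ((ι.2.1 a).factorial : ℂ))⁻¹)
    have hP : P = 0 := by
      refine MvPolynomial.funext fun y => ?_
      have := hzero (y + y₁ - y₀)
      rw [show y₀ + (y + y₁ - y₀) - y₁ = y by abel] at this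
      simp only [P, map_sum, map_zero, MvPolynomial.eval_monomial]
      rw [← this]
      refine Finset.sum_congr rfl fun ι _ => ?_
      rw [Finsupp.prod_fintype _ _ (by simp), mono, Finset.prod_div_distrib]
      field_simp
    funext ι
    have e := congrArg (MvPolynomial.coeff ι.2.1) hP
    simp only [P, MvPolynomial.coeff_sum, MvPolynomial.coeff_monomial, MvPolynomial.coeff_zero] at e
    rw [Finset.sum_eq_single ι] at e
    · rw [if_pos rfl] at e
      refine (mul_eq_zero.1 e).resolve_right (inv_ne_zero ?_)
      exact Finset.prod_ne_zero_iff.2 fun a _ => by exact_mod_cast (ι.2.1 a).factorial_ne_zero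
    · rintro ⟨⟨s, hs⟩, K⟩ - hne
      refine if_neg fun hK => hne ?_
      obtain ⟨⟨s', hs'⟩, K'⟩ := ι
      have e1 := MultiIndex.sum_eq K
      have e2 := MultiIndex.sum_eq K'
      simp only at e1 e2 hK
      rw [hK] at e1
      obtain rfl : s = s' := e1.symm.trans e2
      rw [Subtype.ext hK]
    · simp
  funext ι
  refine SeparatingDual.eq_zero_of_forall_dual_eq_zero (R := ℂ) fun φ => ?_
  have h2 := (φ.isBigO_comp (fun y => ∑ ι, mono ι.2.1 (y - y₁) • c ι) (𝓝 y₀)).trans h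
  simp only [map_sum, map_smul, smul_eq_mul] at h2
  exact congrFun (scalar (fun ι => φ (c ι)) (by simpa only [mul_comm] using h2)) ι

theorem norm_mono_le {r k : ℕ} (K : MultiIndex r k) (y : Fin r → ℂ) : ‖mono K.1 y‖ ≤ ‖y‖ ^ k := by
  have e : ‖y‖ ^ k = ∏ a, ‖y‖ ^ K.1 a := by
    rw [Finset.prod_pow_eq_pow_sum, MultiIndex.sum_eq K]
  rw [mono, norm_prod, e]
  refine Finset.prod_le_prod (fun _ _ => norm_nonneg _) fun a _ => ?_
  rw [norm_div, norm_pow, RCLike.norm_natCast]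
  refine (div_le_self (by positivity) (by exact_mod_cast (K.1 a).factorial_pos)).trans ?_
  exact pow_le_pow_left₀ (norm_nonneg _) (norm_le_pi_norm y a) _

/-- If `f` vanishes to order `k` at `y₀`, its leading part is homogeneous of degree `k`. -/
theorem exists_leading_part {F : Type*} [NormedAddCommGroup F] [NormedSpace ℂ F] {r : ℕ}
    {f : (Fin r → ℂ) → F} {y₀ : Fin r → ℂ} (hf : AnalyticAt ℂ f y₀) (k : ℕ)
    (hO : f =O[𝓝 y₀] fun y => ‖y - y₀‖ ^ k) :
    ∃ c : MultiIndex r k → F,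
      (fun y => f y - ∑ K, mono K.1 (y - y₀) • c K) =O[𝓝 y₀] fun y => ‖y - y₀‖ ^ (k + 1) := by
  obtain ⟨c, hc⟩ := exists_taylor hf y₀ k
  refine ⟨fun K => c ⟨Fin.last k, K⟩, ?_⟩
  have hsplit : ∀ y, ∑ ι, mono ι.2.1 (y - y₀) • c ι =
      ∑ i : Fin k, ∑ K : MultiIndex r i, mono K.1 (y - y₀) • c ⟨i.castSucc, K⟩ +
        ∑ K : MultiIndex r k, mono K.1 (y - y₀) • c ⟨Fin.last k, K⟩ := fun y => by
    rw [Fintype.sum_sigma, Fin.sum_univ_castSucc]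
    rfl
  simp only [hsplit] at hc
  -- the terms of degree less than `k` vanish
  suffices h0 : ∀ y, ∑ i : Fin k, ∑ K : MultiIndex r i,
      mono K.1 (y - y₀) • c ⟨i.castSucc, K⟩ = 0 by simpa only [h0, zero_add] using hc
  obtain _ | k := k
  · simp
  have hlast : (fun y => ∑ K : MultiIndex r (k + 1), mono K.1 (y - y₀) • c ⟨Fin.last (k + 1), K⟩)
      =O[𝓝 y₀] fun y => ‖y - y₀‖ ^ (k + 1) := by
    refine Asymptotics.IsBigO.fun_sum fun K _ => ?_
    refine Asymptotics.IsBigO.of_bound ‖c ⟨Fin.last (k + 1), K⟩‖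
      (Filter.Eventually.of_forall fun y => ?_)
    rw [norm_smul, norm_pow, norm_norm, mul_comm]
    exact mul_le_mul_of_nonneg_left (norm_mono_le K _) (norm_nonneg _)
  have hlow := ((hO.sub (hc.trans (isBigO_pow_of_le (Nat.le_succ _)))).sub hlast)
  simp only [sub_sub_cancel, add_sub_cancel_right] at hlow
  let c' : MultiIndexLE r k → F := fun ι => c ⟨ι.1.castSucc, ι.2⟩
  have hc' : c' = 0 := by
    refine coeff_eq_zero_of_isBigO (y₀ := y₀) (y₁ := y₀) ?_
    simpa only [Fintype.sum_sigma] using hlow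
  intro y
  refine Finset.sum_eq_zero fun i _ => Finset.sum_eq_zero fun K _ => ?_
  have : c ⟨i.castSucc, K⟩ = 0 := congrFun hc' ⟨i, K⟩
  rw [this, smul_zero]

/-! ### Pullback of differential forms -/

section Pullback

variable {E F G : Type*} [NormedAddCommGroup E] [NormedSpace ℂ E]
  [NormedAddCommGroup F] [NormedSpace ℂ F] [NormedAddCommGroup G] [NormedSpace ℂ G] {p : ℕ}

/-- The pullback `f^* ω` of a differential form. -/
noncomputable def pullback (f : E → F) (ω : F → F [⋀^Fin p]→L[ℂ] ℂ) (z : E) : E [⋀^Fin p]→L[ℂ] ℂ :=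
  (ω (f z)).compContinuousLinearMap (fderiv ℂ f z)

theorem pullback_apply (f : E → F) (ω : F → F [⋀^Fin p]→L[ℂ] ℂ) (z : E) (w : Fin p → E) :
    pullback f ω z w = ω (f z) (fun i => fderiv ℂ f z (w i)) := rfl

theorem pullback_pullback {f : F → G} {g : E → F} {z : E} (hf : DifferentiableAt ℂ f (g z))
    (hg : DifferentiableAt ℂ g z) (ω : G → G [⋀^Fin p]→L[ℂ] ℂ) :
    pullback g (pullback f ω) z = pullback (f ∘ g) ω z := by
  ext w
  simp only [pullback_apply, fderiv_comp z hf hg]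
  rfl

theorem pullback_eq_self {f : E → E} {z : E} (hf : f =ᶠ[𝓝 z] id) (ω : E → E [⋀^Fin p]→L[ℂ] ℂ) :
    pullback f ω z = ω z := by
  ext w
  simp only [pullback_apply, hf.fderiv_eq, hf.self_of_nhds]
  simp

/-- Pulling back preserves the order of vanishing. -/
theorem pullback_isBigO {f : E → F} {x : E} (hf : ContDiffAt ℂ 1 f x)
    {ω : F → F [⋀^Fin p]→L[ℂ] ℂ} {k : ℕ} (hω : ω =O[𝓝 (f x)] fun y => ‖y - f x‖ ^ k) :
    pullback f ω =O[𝓝 x] fun z => ‖z - x‖ ^ k := by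
  have hd : DifferentiableAt ℂ f x := hf.differentiableAt one_ne_zero
  have h1 : (fun z => ω (f z)) =O[𝓝 x] fun z => ‖z - x‖ ^ k :=
    (hω.comp_tendsto hd.continuousAt).trans (hd.isBigO_sub.norm_norm.pow k)
  have h2 : (fun z => ‖fderiv ℂ f z‖ ^ p) =O[𝓝 x] fun _ => (1 : ℝ) :=
    ((hf.continuousAt_fderiv one_ne_zero).norm.pow p).isBigO_one ℝ
  have h3 : pullback f ω =O[𝓝 x] fun z => ‖ω (f z)‖ * ‖fderiv ℂ f z‖ ^ p := by
    refine Asymptotics.IsBigO.of_bound 1 (Filter.Eventually.of_forall fun z => ?_)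
    have := (ω (f z)).norm_compContinuousLinearMap_le (fderiv ℂ f z)
    rw [one_mul]
    exact this.trans (by simp)
  simpa using h3.trans (h1.norm_left.mul h2)

theorem analyticAt_apply [CompleteSpace F] {ω : E → F [⋀^Fin p]→L[ℂ] ℂ} {v : Fin p → E → F} {z : E}
    (hω : AnalyticAt ℂ ω z) (hv : ∀ i, AnalyticAt ℂ (v i) z) :
    AnalyticAt ℂ (fun z => ω z (fun i => v i z)) z := by
  have h1 := (ContinuousAlternatingMap.toContinuousMultilinearMapCLM (𝕜 := ℂ) (E := F) (F := ℂ)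
    (ι := Fin p) ℂ).analyticAt_uncurry_of_multilinear (x := (ω z, fun i => v i z))
  exact h1.comp₂ (f := fun z => ω z) (g := fun z => fun i => v i z) hω (analyticAt_pi_iff.2 hv)

/-- A form is analytic iff its coefficients are. -/
theorem analyticAt_cov_iff {r : ℕ} {ω : E → Cov r p} {z : E} :
    AnalyticAt ℂ ω z ↔
      ∀ B : Increasing p r, AnalyticAt ℂ (fun z => ω z (fun s => Pi.single (B s) 1)) z := by
  refine ⟨fun h B => analyticAt_apply h fun _ => analyticAt_const, fun h => ?_⟩
  have : ω = fun z => ∑ B : Increasing p r, ω z (fun s => Pi.single (B s) 1) • covBasis B :=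
    funext fun z => cov_eq_sum _
  rw [this]
  exact Finset.analyticAt_fun_sum _ fun B _ => (h B).smul analyticAt_const

theorem analyticAt_pullback [CompleteSpace F] {r : ℕ} {f : (Fin r → ℂ) → F}
    {ω : F → F [⋀^Fin p]→L[ℂ] ℂ}
    {z : Fin r → ℂ} (hf : AnalyticAt ℂ f z) (hω : AnalyticAt ℂ ω (f z)) :
    AnalyticAt ℂ (pullback f ω) z := by
  refine analyticAt_cov_iff.2 fun B => ?_
  refine analyticAt_apply (ω := fun z => ω (f z)) (v := fun s z => fderiv ℂ f z (Pi.single (B s) 1))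
    (hω.comp hf) fun s => ?_
  exact ((ContinuousLinearMap.apply ℂ F (Pi.single (B s) (1 : ℂ) : Fin r → ℂ)).analyticAt
    (fderiv ℂ f z)).comp hf.fderiv

/-- If a covector vanishes as soon as one of its arguments lies in `K`, then it only depends on
its arguments modulo `K`. -/
theorem apply_eq_of_sub_mem (η : E [⋀^Fin p]→L[ℂ] ℂ) (K : Submodule ℂ E)
    (h : ∀ w : Fin p → E, (∃ j, w j ∈ K) → η w = 0) {v w : Fin p → E} (hvw : ∀ j, v j - w j ∈ K) :
    η v = η w := by
  classical
  have e := η.toMultilinearMap.map_add_univ w (v - w)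
  rw [add_sub_cancel] at e
  refine Eq.trans e ?_
  rw [Finset.sum_eq_single Finset.univ]
  · simp
  · intro s _ hs
    obtain ⟨j, hj⟩ : ∃ j, j ∉ s := by
      by_contra! hc
      exact hs (Finset.eq_univ_iff_forall.2 hc)
    exact h _ ⟨j, by simpa [Finset.piecewise, hj] using hvw j⟩
  · simp

end Pullback

/-! ### Basic forms are pullbacks -/

variable {n q d : ℕ} {U : Set (Fin n → ℂ)}

/-- Near `m` the foliation `F` is defined by the submersion `u`. -/
def IsDefining (F : Foliation n q U) (m : Fin n → ℂ) (u : (Fin n → ℂ) → (Fin q → ℂ)) : Prop :=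
  ∀ᶠ x in 𝓝 m, AnalyticAt ℂ u x ∧ Function.Surjective (fderiv ℂ u x) ∧
    ∀ v, v ∈ F.tangent x ↔ fderiv ℂ u x v = 0

theorem IsGeneratingSystem.isDefining {F : Foliation n q U} {m : Fin n → ℂ}
    {u : (Fin n → ℂ) → (Fin q → ℂ)} (hm : m ∈ U) (hu : IsGeneratingSystem F m u) :
    IsDefining F m u := by
  obtain ⟨u', hu'⟩ := F.exists_submersion m hm
  filter_upwards [hu, hu'] with x h1 h2
  refine ⟨h1.1, h1.2.2, fun v => ⟨h1.2.1 v, fun hv => ?_⟩⟩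
  -- both kernels have dimension `n - q`
  let A : (Fin n → ℂ) →ₗ[ℂ] (Fin q → ℂ) := (fderiv ℂ u x : (Fin n → ℂ) →L[ℂ] (Fin q → ℂ))
  let A' : (Fin n → ℂ) →ₗ[ℂ] (Fin q → ℂ) := (fderiv ℂ u' x : (Fin n → ℂ) →L[ℂ] (Fin q → ℂ))
  have hle : F.tangent x ≤ LinearMap.ker A := fun v hv => h1.2.1 v hv
  have ht : F.tangent x = LinearMap.ker A' := h2.2.2.symm
  have e1 := A.finrank_range_add_finrank_ker
  have e2 := A'.finrank_range_add_finrank_ker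
  rw [LinearMap.range_eq_top.2 h1.2.2] at e1
  rw [LinearMap.range_eq_top.2 h2.2.1] at e2
  have : F.tangent x = LinearMap.ker A :=
    Submodule.eq_of_le_of_finrank_eq hle (by rw [ht]; omega)
  rw [this]
  exact hv

/-- A submersion `u` is the first component of a local analytic coordinate system. -/
theorem exists_straightening {u : (Fin n → ℂ) → (Fin q → ℂ)} {x : Fin n → ℂ}
    (hu : AnalyticAt ℂ u x) (hs : Function.Surjective (fderiv ℂ u x)) :
    ∃ (K : Submodule ℂ (Fin n → ℂ)) (φ : OpenPartialHomeomorph (Fin n → ℂ) ((Fin q → ℂ) × K)),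
      x ∈ φ.source ∧ AnalyticAt ℂ φ x ∧ AnalyticAt ℂ φ.symm (φ x) ∧ ∀ z, (φ z).1 = u z := by
  have hf := hu.hasStrictFDerivAt
  have hr : (fderiv ℂ u x).range = ⊤ := LinearMap.range_eq_top.2 hs
  have hker : (fderiv ℂ u x).ker.ClosedComplemented :=
    Submodule.ClosedComplemented.of_finiteDimensional _
  let φ := hf.implicitToOpenPartialHomeomorphOfComplemented u _ hr hker
  have hx : x ∈ φ.source := hf.mem_implicitToOpenPartialHomeomorphOfComplemented_source hr hker
  have hφ : AnalyticAt ℂ φ x := by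
    have : AnalyticAt ℂ (fun z => (u z, Classical.choose hker (z - x))) x :=
      hu.prod ((Classical.choose hker).analyticAt _ |>.comp (analyticAt_id.sub analyticAt_const))
    exact this
  have hinv : (fderiv ℂ φ x).IsInvertible :=
    (ImplicitFunctionData.isInvertible_fderiv_prodFun
      (HasStrictFDerivAt.implicitFunctionDataOfComplemented u _ hf hr hker))
  obtain ⟨i, hi⟩ := hinv
  exact ⟨_, φ, hx, hφ, φ.analyticAt_symm' hx hφ hi.symm, fun z => rfl⟩

/-- A submersion has a local analytic section. -/
theorem exists_section {u : (Fin n → ℂ) → (Fin q → ℂ)} {x : Fin n → ℂ}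
    (hu : AnalyticAt ℂ u x) (hs : Function.Surjective (fderiv ℂ u x)) :
    ∃ s : (Fin q → ℂ) → (Fin n → ℂ), AnalyticAt ℂ s (u x) ∧ s (u x) = x ∧ u ∘ s =ᶠ[𝓝 (u x)] id := by
  obtain ⟨K, φ, hx, hφ, hψ, h1⟩ := exists_straightening hu hs
  have hcont : Filter.Tendsto (fun y : Fin q → ℂ => (y, (φ x).2)) (𝓝 (u x)) (𝓝 (φ x)) := by
    have : Continuous fun y : Fin q → ℂ => (y, (φ x).2) := by fun_prop
    rw [← h1 x]
    exact this.tendsto (φ x).1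
  refine ⟨fun y => φ.symm (y, (φ x).2), ?_, ?_, ?_⟩
  · have e : (u x, (φ x).2) = φ x := Prod.ext (h1 x).symm rfl
    refine AnalyticAt.comp (g := φ.symm) (f := fun y => (y, (φ x).2)) (by rwa [e]) ?_
    exact analyticAt_id.prod analyticAt_const
  · have e : (u x, (φ x).2) = φ x := Prod.ext (h1 x).symm rfl
    simp only [e]
    exact φ.left_inv hx
  · have ht : φ.target ∈ 𝓝 (φ x) := φ.open_target.mem_nhds (φ.map_source hx)
    filter_upwards [hcont ht] with y hy
    simp only [Function.comp_apply, ← h1, φ.right_inv hy, id]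

/-- The pullback by `u` of an analytic form is basic. -/
theorem IsDefining.isBasicNear_pullback {F : Foliation n q U} {m : Fin n → ℂ}
    {u : (Fin n → ℂ) → (Fin q → ℂ)} (hu : IsDefining F m u) {p : ℕ} {η : (Fin q → ℂ) → Cov q p}
    (hη : AnalyticAt ℂ η (u m)) : IsBasicNear F m (pullback u η) := by
  have hc : ContinuousAt u m := hu.self_of_nhds.1.continuousAt
  filter_upwards [hu, hc.eventually hη.eventually_analyticAt] with x hx hηx
  refine ⟨analyticAt_pullback hx.1 hηx, fun w hw => ?_, fun v hv w => ?_⟩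
  · obtain ⟨j, hj⟩ := hw
    rw [pullback_apply]
    exact (η (u x)).map_coord_zero j ((hx.2.2 _).1 hj)
  · have e := extDeriv_pullback (r := ⊤) hηx.differentiableAt hx.1.contDiffAt (by simp)
    have e' : extDeriv (pullback u η) x = _ := e
    rw [e', ContinuousAlternatingMap.compContinuousLinearMap_apply]
    refine (extDeriv η (u x)).map_coord_zero 0 ?_
    simpa using (hx.2.2 _).1 hv

/-- A basic form is, locally, the pullback by `u` of an analytic form: in coordinates
straightening the foliation, it does not involve the coordinates along the leaves. -/
theorem IsBasicNear.exists_eq_pullback {F : Foliation n q U} {m : Fin n → ℂ}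
    {u : (Fin n → ℂ) → (Fin q → ℂ)} (hu : IsDefining F m u) {p : ℕ} {ω : (Fin n → ℂ) → Cov n p}
    (hω : IsBasicNear F m ω) :
    ∃ η : (Fin q → ℂ) → Cov q p, AnalyticAt ℂ η (u m) ∧ ω =ᶠ[𝓝 m] pullback u η := by
  obtain ⟨K, φ, hm, hφ, hψ, h1⟩ :=
    exists_straightening hu.self_of_nhds.1 hu.self_of_nhds.2.1
  have hψm : φ.symm (φ m) = m := φ.left_inv hm
  have hgood : ∀ᶠ P in 𝓝 (φ m), P ∈ φ.target ∧ AnalyticAt ℂ φ.symm P ∧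
      (AnalyticAt ℂ u (φ.symm P) ∧ Function.Surjective (fderiv ℂ u (φ.symm P)) ∧
        ∀ v, v ∈ F.tangent (φ.symm P) ↔ fderiv ℂ u (φ.symm P) v = 0) ∧
      (AnalyticAt ℂ ω (φ.symm P) ∧ IsSemibasicAt F ω (φ.symm P) ∧
        IsInvariantAt F ω (φ.symm P)) := by
    have hc : Filter.Tendsto φ.symm (𝓝 (φ m)) (𝓝 m) := by
      have := hψ.continuousAt
      rwa [ContinuousAt, hψm] at this
    filter_upwards [φ.open_target.mem_nhds (φ.map_source hm), hψ.eventually_analyticAt,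
      hc.eventually hu, hc.eventually hω] with P a1 a2 a3 a4
    exact ⟨a1, a2, a3, a4⟩
  obtain ⟨ε, hε, hball⟩ := Metric.eventually_nhds_iff_ball.1 hgood
  let ω' := pullback φ.symm ω
  have hDu : ∀ P ∈ Metric.ball (φ m) ε, ∀ v, fderiv ℂ u (φ.symm P) (fderiv ℂ φ.symm P v) = v.1 := by
    intro P hP v
    obtain ⟨ht, hψP, ⟨huP, -, -⟩, -⟩ := hball P hP
    have e : u ∘ φ.symm =ᶠ[𝓝 P] Prod.fst := by
      filter_upwards [φ.open_target.mem_nhds ht] with Q hQ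
      rw [Function.comp_apply, ← h1, φ.right_inv hQ]
    have e2 := e.fderiv_eq (𝕜 := ℂ)
    rw [fderiv_comp P huP.differentiableAt hψP.differentiableAt, fderiv_fst] at e2
    exact congrArg (fun L => L v) e2
  -- in the straightened coordinates `ω'` does not involve the differentials of the coordinates
  -- along the leaves
  have hsemi : ∀ P ∈ Metric.ball (φ m) ε, ∀ w : Fin p → (Fin q → ℂ) × K, (∃ j, (w j).1 = 0) →
      ω' P w = 0 := by
    rintro P hP w ⟨j, hj⟩
    obtain ⟨ht, hψP, ⟨-, -, htan⟩, -, hsb, -⟩ := hball P hP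
    exact hsb _ ⟨j, (htan _).2 ((hDu P hP (w j)).trans hj)⟩
  have hdiff : ∀ P ∈ Metric.ball (φ m) ε, DifferentiableAt ℂ ω' P := by
    intro P hP
    obtain ⟨ht, hψP, -, hωP, -⟩ := hball P hP
    have hd1 : DifferentiableAt ℂ (fun P => ω (φ.symm P)) P :=
      hωP.differentiableAt.comp P hψP.differentiableAt
    exact (hd1.hasFDerivAt.continuousAlternatingMapCompContinuousLinearMap
      hψP.fderiv.differentiableAt.hasFDerivAt).differentiableAt
  -- the coefficients of `ω'` are constant along the leaves: in `dω' (t, w)` with `t` tangent to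
  -- the leaves only the derivative along `t` survives
  have hder : ∀ P ∈ Metric.ball (φ m) ε, ∀ (w : Fin p → (Fin q → ℂ) × K) (t : K),
      fderiv ℂ (fun P => ω' P w) P (0, t) = 0 := by
    intro P hP w t
    obtain ⟨ht, hψP, ⟨-, -, htan⟩, hωP, -, hinv⟩ := hball P hP
    have e1 : extDeriv ω' P (Fin.cons (0, t) w : Fin (p + 1) → (Fin q → ℂ) × K) = 0 := by
      have e := extDeriv_pullback (r := ⊤) hωP.differentiableAt hψP.contDiffAt (by simp)
      have e' : extDeriv ω' P = _ := e
      rw [e', ContinuousAlternatingMap.compContinuousLinearMap_apply]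
      have e3 := hinv (fderiv ℂ φ.symm P (0, t)) ((htan _).2 (by rw [hDu P hP]))
        (fun i => fderiv ℂ φ.symm P (w i))
      rw [← e3]
      congr 1
      funext i
      refine Fin.cases ?_ (fun i => ?_) i <;> simp
    rw [extDeriv_apply (hdiff P hP), Fin.sum_univ_succ, Finset.sum_eq_zero, add_zero] at e1
    · simpa using e1
    · intro i _
      have hev : (fun Q => ω' Q (i.succ.removeNth
          (Fin.cons (0, t) w : Fin (p + 1) → (Fin q → ℂ) × K))) =ᶠ[𝓝 P] fun _ => 0 := by
        filter_upwards [Metric.isOpen_ball.mem_nhds hP] with Q hQ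
        obtain _ | p := p
        · exact i.elim0
        · exact hsemi Q hQ _ ⟨0, by simp [Fin.removeNth]⟩
      rw [hev.fderiv_eq]
      simp
  have hconst : ∀ P ∈ Metric.ball (φ m) ε, ω' P = ω' (P.1, (φ m).2) := by
    intro P hP
    ext w
    have hPd : dist P.1 (φ m).1 < ε ∧ dist P.2 (φ m).2 < ε := by
      simpa [Prod.dist_eq] using hP
    have hmem : ∀ t ∈ Metric.ball (φ m).2 ε, (P.1, t) ∈ Metric.ball (φ m) ε := fun t ht => by
      rw [Metric.mem_ball, Prod.dist_eq]
      exact max_lt hPd.1 ht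
    have hd : ∀ t ∈ Metric.ball (φ m).2 ε, HasFDerivAt (fun t : K => ω' (P.1, t) w)
        ((fderiv ℂ (fun P => ω' P w) (P.1, t)).comp
          (ContinuousLinearMap.inr ℂ (Fin q → ℂ) K)) t := by
      intro t ht
      have hda : DifferentiableAt ℂ (fun P => ω' P w) (P.1, t) := by
        have := hdiff _ (hmem t ht)
        fun_prop
      exact hda.hasFDerivAt.comp t (hasFDerivAt_prodMk_right P.1 t)
    refine Metric.isOpen_ball.is_const_of_fderiv_eq_zero (𝕜 := ℂ)
      (f := fun t : K => ω' (P.1, t) w) (convex_ball (φ m).2 ε).isPreconnected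
      (fun t ht => (hd t ht).differentiableAt.differentiableWithinAt) (fun t ht => ?_) hPd.2
      (Metric.mem_ball_self hε)
    rw [(hd t ht).fderiv]
    ext v
    simpa using hder _ (hmem t ht) w v
  have hm2 : (u m, (φ m).2) = φ m := Prod.ext (h1 m).symm rfl
  -- restrict `ω` to the transversal through `m`
  refine ⟨pullback (fun y => φ.symm (y, (φ m).2)) ω, ?_, ?_⟩
  · refine analyticAt_pullback ?_ (by simpa only [hm2, hψm] using hω.analyticAt)
    exact AnalyticAt.comp (g := φ.symm) (f := fun y => (y, (φ m).2)) (by rwa [hm2])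
      (analyticAt_id.prod analyticAt_const)
  · filter_upwards [hφ.eventually_analyticAt, φ.open_source.mem_nhds hm,
      hφ.continuousAt (Metric.ball_mem_nhds _ hε), hu] with z hz hzs hzb huz
    have hy : (u z, (φ m).2) ∈ Metric.ball (φ m) ε := by
      have hzd : dist (φ z).1 (φ m).1 < ε ∧ dist (φ z).2 (φ m).2 < ε := by
        simpa [Prod.dist_eq] using hzb
      rw [Metric.mem_ball, Prod.dist_eq, ← h1]
      exact max_lt hzd.1 (by simpa using hε)
    have e1 : ω z = pullback φ ω' z := by
      rw [pullback_pullback (hball _ hzb).2.1.differentiableAt hz.differentiableAt,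
        pullback_eq_self]
      filter_upwards [φ.open_source.mem_nhds hzs] with z' hz'
      simp [φ.left_inv hz']
    have hφu : ∀ v, (fderiv ℂ φ z v).1 = fderiv ℂ u z v := fun v => by
      have e := (hz.differentiableAt.hasFDerivAt.fst).fderiv
      rw [show (fun z => (φ z).1) = u from funext h1] at e
      rw [e]; rfl
    have hs : ∀ v, fderiv ℂ (fun y => φ.symm (y, (φ m).2)) (u z) v =
        fderiv ℂ φ.symm (u z, (φ m).2) (v, 0) := fun v => by
      have := (HasFDerivAt.comp (u z) (g := φ.symm) (f := fun y => (y, (φ m).2))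
        (hball _ hy).2.1.differentiableAt.hasFDerivAt
        (hasFDerivAt_prodMk_left (𝕜 := ℂ) (u z) (φ m).2)).fderiv
      rw [show (fun y => φ.symm (y, (φ m).2)) = φ.symm ∘ fun y => (y, (φ m).2) from rfl, this]
      rfl
    rw [e1]
    ext w
    rw [pullback_apply, hconst _ hzb, h1]
    refine (apply_eq_of_sub_mem (ω' (u z, (φ m).2)) (LinearMap.ker (LinearMap.fst ℂ (Fin q → ℂ) K))
      (fun v hv => hsemi _ hy v (by simpa using hv))
      (w := fun i => (fderiv ℂ u z (w i), 0)) fun j => ?_).trans ?_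
    · simp [hφu]
    · simp only [pullback_apply, hs]
      rfl

/-! ### Polynomial forms -/

/-- The form `(y - y₁)^K / K! dy_A`. -/
noncomputable def elemForm {p r : ℕ} (y₁ : Fin r → ℂ) (A : Increasing p r) (K : Fin r →₀ ℕ)
    (y : Fin r → ℂ) : Cov r p :=
  mono K (y - y₁) • covBasis A

theorem cov_zero_smul {p r : ℕ} (η : Cov r p) : (0 : ℂ) • η = 0 := zero_smul ℂ η

theorem cov_sum_smul {p r : ℕ} {I : Type*} (s : Finset I) (f : I → ℂ) (η : Cov r p) :
    (∑ i ∈ s, f i) • η = ∑ i ∈ s, f i • η := by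
  ext w
  rw [ContinuousAlternatingMap.sum_apply]
  exact Finset.sum_mul _ _ _

theorem analyticAt_smul_form {E : Type*} [NormedAddCommGroup E] [NormedSpace ℂ E] {p r : ℕ}
    {f : E → ℂ} {η : E → Cov r p} {x : E} (hf : AnalyticAt ℂ f x) (hη : AnalyticAt ℂ η x) :
    AnalyticAt ℂ (fun z => f z • η z) x := hf.smul hη

theorem analyticAt_elemForm {p r : ℕ} (y₁ : Fin r → ℂ) (A : Increasing p r) (K : Fin r →₀ ℕ)
    (y : Fin r → ℂ) : AnalyticAt ℂ (elemForm y₁ A K) y := by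
  refine analyticAt_smul_form ?_ analyticAt_const
  refine Finset.analyticAt_fun_prod _ fun a _ => ?_
  simp only [div_eq_mul_inv]
  refine AnalyticAt.mul (AnalyticAt.pow ?_ _) analyticAt_const
  exact ((ContinuousLinearMap.proj (R := ℂ) (φ := fun _ : Fin r => ℂ) a).analyticAt _).sub
    analyticAt_const

theorem sum_elemForm {p r : ℕ} {I : Type*} [Fintype I] (K : I → Fin r →₀ ℕ)
    (c : Increasing p r × I → ℂ) (y₁ y : Fin r → ℂ) :
    ∑ s, c s • elemForm y₁ s.1 (K s.2) y =
      ∑ ι, mono (K ι) (y - y₁) • ∑ A, c (A, ι) • covBasis A := by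
  rw [Fintype.sum_prod_type_right]
  refine Finset.sum_congr rfl fun ι _ => ?_
  rw [Finset.smul_sum]
  refine Finset.sum_congr rfl fun A _ => ?_
  rw [elemForm, smul_comm]

/-- Taylor expansion of order `k` at `y₀` of a form, in powers of `y - y₁`. The base point `y₁` is
kept fixed when `y₀` varies, so that the monomial forms do not depend on `y₀`. -/
theorem exists_taylor_form {p r : ℕ} {η : (Fin r → ℂ) → Cov r p} {y₀ : Fin r → ℂ}
    (hη : AnalyticAt ℂ η y₀) (y₁ : Fin r → ℂ) (k : ℕ) :
    ∃ c : Increasing p r × MultiIndexLE r k → ℂ,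
      (fun y => η y - ∑ s, c s • elemForm y₁ s.1 s.2.2.1 y) =O[𝓝 y₀]
        fun y => ‖y - y₀‖ ^ (k + 1) := by
  obtain ⟨c, hc⟩ := exists_taylor hη y₁ k
  refine ⟨fun s => c s.2 (fun t => Pi.single (s.1 t) 1), ?_⟩
  simp only [sum_elemForm (fun ι : MultiIndexLE r k => ι.2.1), ← cov_eq_sum]
  exact hc

/-- A form vanishing to order `k` at `y₀` has a homogeneous leading part of degree `k`. -/
theorem exists_leading_form {p r : ℕ} {η : (Fin r → ℂ) → Cov r p} {y₀ : Fin r → ℂ}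
    (hη : AnalyticAt ℂ η y₀) (k : ℕ) (hO : η =O[𝓝 y₀] fun y => ‖y - y₀‖ ^ k) :
    ∃ c : Increasing p r × MultiIndex r k → ℂ,
      (fun y => η y - ∑ s, c s • elemForm y₀ s.1 s.2.1 y) =O[𝓝 y₀]
        fun y => ‖y - y₀‖ ^ (k + 1) := by
  obtain ⟨c, hc⟩ := exists_leading_part hη k hO
  refine ⟨fun s => c s.2 (fun t => Pi.single (s.1 t) 1), ?_⟩
  simp only [sum_elemForm (fun K : MultiIndex r k => K.1), ← cov_eq_sum]
  exact hc

/-- A polynomial form of degree at most `k` which vanishes to order `k + 1` somewhere is zero. -/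
theorem form_coeff_eq_zero {p r k : ℕ} {y₀ y₁ : Fin r → ℂ}
    {c : Increasing p r × MultiIndexLE r k → ℂ}
    (h : (fun y => ∑ s, c s • elemForm y₁ s.1 s.2.2.1 y) =O[𝓝 y₀] fun y => ‖y - y₀‖ ^ (k + 1)) :
    c = 0 := by
  simp only [sum_elemForm (fun ι : MultiIndexLE r k => ι.2.1)] at h
  have h0 := coeff_eq_zero_of_isBigO h
  funext ⟨A, ι⟩
  have e := congrArg (fun η : Cov r p => η (fun t => Pi.single (A t) 1)) (congrFun h0 ι)
  exact (covBasis_coeff (fun A => c (A, ι)) A).symm.trans e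

/-- A homogeneous polynomial form of degree `k` which vanishes to order `k + 1` is zero. -/
theorem leading_coeff_eq_zero {p r k : ℕ} {y₀ : Fin r → ℂ}
    {c : Increasing p r × MultiIndex r k → ℂ}
    (h : (fun y => ∑ s, c s • elemForm y₀ s.1 s.2.1 y) =O[𝓝 y₀] fun y => ‖y - y₀‖ ^ (k + 1)) :
    c = 0 := by
  classical
  let c' : Increasing p r × MultiIndexLE r k → ℂ := fun s =>
    ∑ K : MultiIndex r k, if s.2 = ⟨Fin.last k, K⟩ then c (s.1, K) else 0
  have hc' : c' = 0 := by
    refine form_coeff_eq_zero (y₀ := y₀) (y₁ := y₀) (h.congr_left fun y => ?_)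
    rw [Fintype.sum_prod_type, Fintype.sum_prod_type]
    refine Finset.sum_congr rfl fun A _ => ?_
    simp only [c', cov_sum_smul]
    rw [Finset.sum_comm]
    refine Finset.sum_congr rfl fun K _ => ?_
    rw [Finset.sum_eq_single ⟨Fin.last k, K⟩]
    · simp
    · intro ι _ hι
      rw [if_neg hι, cov_zero_smul]
    · simp
  funext ⟨A, K⟩
  have e := congrFun hc' (A, ⟨Fin.last k, K⟩)
  simpa [c', eq_comm] using e

/-! ### Leading parts of pullbacks -/

section BigO

variable {E F : Type*} [NormedAddCommGroup E] [NormedAddCommGroup F] [NormedSpace ℂ F] {x : E}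

/-- The leading part of a product is the product of the leading parts. -/
theorem isBigO_smul_sub_smul {f f' : E → ℂ} {g g' : E → F} {a b : ℕ}
    (hf' : f' =O[𝓝 x] fun z => ‖z - x‖ ^ a) (hg' : g' =O[𝓝 x] fun z => ‖z - x‖ ^ b)
    (hf : (fun z => f z - f' z) =O[𝓝 x] fun z => ‖z - x‖ ^ (a + 1))
    (hg : (fun z => g z - g' z) =O[𝓝 x] fun z => ‖z - x‖ ^ (b + 1)) :
    (fun z => f z • g z - f' z • g' z) =O[𝓝 x] fun z => ‖z - x‖ ^ (a + b + 1) := by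
  have hg2 : g =O[𝓝 x] fun z => ‖z - x‖ ^ b := by
    simpa using hg'.add (hg.trans (isBigO_pow_of_le (Nat.le_succ b)))
  have h1 := hf.smul hg2
  have h2 := hf'.smul hg
  simp only [smul_eq_mul, ← pow_add] at h1 h2
  rw [show a + 1 + b = a + b + 1 by ring] at h1
  rw [← add_assoc] at h2
  refine (h1.add h2).congr_left fun z => ?_
  rw [sub_smul, smul_sub]
  abel

theorem isBigO_prod_sub_prod {I : Type*} (s : Finset I) (K : I → ℕ) {f f' : I → E → ℂ}
    (hf' : ∀ a, f' a =O[𝓝 x] fun z => ‖z - x‖ ^ K a)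
    (hf : ∀ a, (fun z => f a z - f' a z) =O[𝓝 x] fun z => ‖z - x‖ ^ (K a + 1)) :
    ((fun z => ∏ a ∈ s, f' a z) =O[𝓝 x] fun z => ‖z - x‖ ^ ∑ a ∈ s, K a) ∧
      (fun z => ∏ a ∈ s, f a z - ∏ a ∈ s, f' a z) =O[𝓝 x]
        fun z => ‖z - x‖ ^ (∑ a ∈ s, K a + 1) := by
  classical
  induction s using Finset.induction_on with
  | empty =>
    simp only [Finset.prod_empty, Finset.sum_empty, pow_zero, sub_self]
    exact ⟨Asymptotics.isBigO_const_const _ one_ne_zero _, Asymptotics.isBigO_zero _ _⟩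
  | insert a s ha ih =>
    simp only [Finset.prod_insert ha, Finset.sum_insert ha]
    refine ⟨?_, isBigO_smul_sub_smul (hf' a) ih.1 (hf a) ih.2⟩
    simpa only [pow_add] using (hf' a).mul ih.1

theorem isBigO_pow_sub_pow {f f' : E → ℂ} (hf' : f' =O[𝓝 x] fun z => ‖z - x‖)
    (hf : (fun z => f z - f' z) =O[𝓝 x] fun z => ‖z - x‖ ^ 2) (k : ℕ) :
    (fun z => f z ^ k - f' z ^ k) =O[𝓝 x] fun z => ‖z - x‖ ^ (k + 1) := by
  have := (isBigO_prod_sub_prod (Finset.range k) (fun _ => 1) (f := fun _ => f) (f' := fun _ => f')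
    (fun _ => by simpa using hf') (fun _ => hf)).2
  simpa using this

end BigO

theorem fderiv_eq_mulVec (u : (Fin n → ℂ) → (Fin q → ℂ)) (m v : Fin n → ℂ) :
    fderiv ℂ u m v = (jacobian u m).mulVec v := by
  conv_lhs => rw [pi_eq_sum_univ' v]
  funext α
  simp [Matrix.mulVec, dotProduct, jacobian, mul_comm]

/-- The leading part of the pullback of `(y - u m)^K / K! dy_A`. -/
theorem pullback_elemForm_isBigO {u : (Fin n → ℂ) → (Fin q → ℂ)} {m : Fin n → ℂ}
    (hu : AnalyticAt ℂ u m) {p h : ℕ} (A : Increasing p q) (K : MultiIndex q h) :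
    (fun z => pullback u (elemForm (u m) A K.1) z -
      ∑ r : Increasing p n × MultiIndex n h,
        (minor (jacobian u m) A r.1 * coeffN (jacobian u m) r.2.1 K.1) • elemForm m r.1 r.2.1 z)
      =O[𝓝 m] fun z => ‖z - m‖ ^ (h + 1) := by
  set D := jacobian u m
  have hmul : ∀ z, D.mulVec (z - m) = fderiv ℂ u m (z - m) := fun z =>
    (fderiv_eq_mulVec u m (z - m)).symm
  have hlin : ∀ α, (fun z => D.mulVec (z - m) α) =O[𝓝 m] fun z => ‖z - m‖ := fun α => by
    simp only [hmul]
    refine Asymptotics.IsBigO.of_bound ‖fderiv ℂ u m‖ (Filter.Eventually.of_forall fun z => ?_)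
    rw [norm_norm]
    exact (norm_le_pi_norm (fderiv ℂ u m (z - m)) α).trans ((fderiv ℂ u m).le_opNorm _)
  -- to first order `u - u m` is given by the Jacobian matrix
  have hquad : ∀ α, (fun z => (u z - u m) α - D.mulVec (z - m) α) =O[𝓝 m] fun z => ‖z - m‖ ^ 2 := by
    intro α
    obtain ⟨P, hP⟩ := hu
    have h1 := (isBigO_sub_iff (f := fun z => u z - P.partialSum 2 (z - m)) (x := m) (k := 2)).1
      (by simpa only [add_sub_cancel_left] using hP.isBigO_sub_partialSum_pow 2)
    have h2 : ∀ z, u z - P.partialSum 2 (z - m) = u z - u m - D.mulVec (z - m) := fun z => by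
      rw [hmul, hP.fderiv_eq, FormalMultilinearSeries.partialSum, Finset.sum_range_succ,
        Finset.sum_range_one, hP.coeff_zero]
      simp only [sub_sub]
      congr 3
    simp only [h2] at h1
    refine Asymptotics.IsBigO.trans (Asymptotics.IsBigO.of_bound 1
      (Filter.Eventually.of_forall fun z => ?_)) h1
    simpa using norm_le_pi_norm (u z - u m - D.mulVec (z - m)) α
  have hmono : (fun z => mono K.1 (D.mulVec (z - m))) =O[𝓝 m] (fun z => ‖z - m‖ ^ h) ∧
      (fun z => mono K.1 (u z - u m) - mono K.1 (D.mulVec (z - m))) =O[𝓝 m]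
        fun z => ‖z - m‖ ^ (h + 1) := by
    have h1 := isBigO_prod_sub_prod (x := m) Finset.univ K.1
      (f := fun a z => (u z - u m) a ^ K.1 a / (K.1 a).factorial)
      (f' := fun a z => D.mulVec (z - m) a ^ K.1 a / (K.1 a).factorial)
      (fun a => by
        simp only [div_eq_inv_mul]
        exact ((hlin a).pow (K.1 a)).const_mul_left _)
      (fun a => by
        simp only [div_eq_inv_mul, ← mul_sub]
        exact (isBigO_pow_sub_pow (hlin a) (hquad a) (K.1 a)).const_mul_left _)
    rw [MultiIndex.sum_eq K] at h1
    exact h1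
  -- to lowest order `u^* dy_A` is its value at `m`, whose coefficients are minors
  let ζ := pullback u (fun _ => covBasis A)
  have hζ : AnalyticAt ℂ ζ m := analyticAt_pullback hu analyticAt_const
  have hζm : ζ m = ∑ B, minor D A B • covBasis B := by
    rw [cov_eq_sum (ζ m)]
    refine Finset.sum_congr rfl fun B _ => ?_
    congr 1
    rw [pullback_apply, covBasis_apply, minor, ← Matrix.det_transpose]
    rfl
  have hmain := isBigO_smul_sub_smul (x := m) (a := h) (b := 0) (g := ζ) (g' := fun _ => ζ m)
    hmono.1 (by simpa using Asymptotics.isBigO_const_const (ζ m) (one_ne_zero (α := ℝ)) (𝓝 m))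
    hmono.2
    (by simpa using hζ.differentiableAt.isBigO_sub.norm_right)
  refine hmain.congr_left fun z => ?_
  congr 1
  rw [mono_mulVec, hζm, Finset.sum_smul_sum, Fintype.sum_prod_type_right]
  refine Finset.sum_congr rfl fun L _ => Finset.sum_congr rfl fun B _ => ?_
  rw [elemForm, smul_smul, smul_smul]
  congr 1
  ring

theorem pullback_sum_smul {p : ℕ} {I : Type*} (s : Finset I) (u : (Fin n → ℂ) → (Fin q → ℂ))
    (c : I → ℂ) (η : I → (Fin q → ℂ) → Cov q p) (z : Fin n → ℂ) :
    pullback u (fun y => ∑ i ∈ s, c i • η i y) z = ∑ i ∈ s, c i • pullback u (η i) z := by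
  ext w
  simp [pullback_apply, ContinuousAlternatingMap.sum_apply]

/-- The matrix `P_h` expresses the leading parts of sums of basic forms. -/
theorem sum_pullback_isBigO {u : Fin d → (Fin n → ℂ) → (Fin q → ℂ)} {m : Fin n → ℂ}
    (hu : ∀ i, AnalyticAt ℂ (u i) m) {p h : ℕ}
    (v : Fin d × Increasing p q × MultiIndex q h → ℂ) :
    (fun z => ∑ i, pullback (u i) (fun y => ∑ s : Increasing p q × MultiIndex q h,
        v (i, s) • elemForm (u i m) s.1 s.2.1 y) z -
      ∑ r, (matrixP (fun i => jacobian (u i) m) p h).mulVec v r • elemForm m r.1 r.2.1 z)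
      =O[𝓝 m] fun z => ‖z - m‖ ^ (h + 1) := by
  have h1 := Asymptotics.IsBigO.fun_sum (s := Finset.univ) (l := 𝓝 m)
    (A := fun (s : Fin d × Increasing p q × MultiIndex q h) z => v s •
      (pullback (u s.1) (elemForm (u s.1 m) s.2.1 s.2.2.1) z -
        ∑ r : Increasing p n × MultiIndex n h, (minor (jacobian (u s.1) m) s.2.1 r.1 *
          coeffN (jacobian (u s.1) m) r.2.1 s.2.2.1) • elemForm m r.1 r.2.1 z))
    (g := fun z => ‖z - m‖ ^ (h + 1))
    (fun s _ => (pullback_elemForm_isBigO (hu s.1) s.2.1 s.2.2).const_smul_left (v s))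
  refine h1.congr_left fun z => ?_
  simp only [smul_sub, Finset.sum_sub_distrib, pullback_sum_smul]
  congr 1
  · rw [Fintype.sum_prod_type]
  · simp only [Finset.smul_sum, Matrix.mulVec, dotProduct, cov_sum_smul]
    rw [Finset.sum_comm]
    refine Finset.sum_congr rfl fun r _ => Finset.sum_congr rfl fun s _ => ?_
    rw [smul_smul, mul_comm]
    rfl

theorem mulVec_surjective_of_rank {I J : Type*} [Fintype I] [Fintype J] (M : Matrix I J ℂ)
    (h : M.rank = Fintype.card I) : Function.Surjective M.mulVec := by
  have : LinearMap.range M.mulVecLin = ⊤ := by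
    apply Submodule.eq_top_of_finrank_eq
    rw [← Matrix.rank, h, Module.finrank_fintype_fun_eq_card]
  exact LinearMap.range_eq_top.1 this

theorem mulVec_injective_of_rank {I J : Type*} [Fintype I] [Fintype J] (M : Matrix I J ℂ)
    (h : M.rank = Fintype.card J) : ∀ v, M.mulVec v = 0 → v = 0 := by
  have e := M.mulVecLin.finrank_range_add_finrank_ker
  rw [← Matrix.rank, h, Module.finrank_fintype_fun_eq_card] at e
  have : LinearMap.ker M.mulVecLin = ⊥ := Submodule.finrank_eq_zero.1 (by omega)
  exact fun v hv => LinearMap.ker_eq_bot'.1 this v hv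

/-- If the matrices `P_0, …, P_{k-1}` have maximal row rank, every analytic form is a sum of
basic forms up to terms vanishing to order `k`. -/
theorem exists_sum_pullback_isBigO {u : Fin d → (Fin n → ℂ) → (Fin q → ℂ)} {m : Fin n → ℂ}
    (hu : ∀ i, AnalyticAt ℂ (u i) m) {p : ℕ} {ω : (Fin n → ℂ) → Cov n p} (hω : AnalyticAt ℂ ω m)
    (k : ℕ) (hP : ∀ h < k, Function.Surjective
      (matrixP (fun i => jacobian (u i) m) p h).mulVec) :
    ∃ η : Fin d → (Fin q → ℂ) → Cov q p, (∀ i, AnalyticAt ℂ (η i) (u i m)) ∧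
      (fun z => ω z - ∑ i, pullback (u i) (η i) z) =O[𝓝 m] fun z => ‖z - m‖ ^ k := by
  induction k with
  | zero =>
    refine ⟨fun _ _ => 0, fun _ => analyticAt_const, ?_⟩
    have : ∀ z, ∑ i, pullback (u i) (fun _ => (0 : Cov q p)) z = 0 := fun z =>
      Finset.sum_eq_zero fun i _ => by ext; simp [pullback_apply]
    simpa [this] using hω.continuousAt.isBigO_one ℝ
  | succ k ih =>
    obtain ⟨η, hη, hO⟩ := ih fun h hh => hP h (by omega)
    have han : AnalyticAt ℂ (fun z => ω z - ∑ i, pullback (u i) (η i) z) m :=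
      hω.sub (Finset.analyticAt_fun_sum _ fun i _ => analyticAt_pullback (hu i) (hη i))
    obtain ⟨c, hc⟩ := exists_leading_form han k hO
    obtain ⟨v, hv⟩ := hP k (Nat.lt_succ_self k) c
    -- add homogeneous terms of degree `k` which cancel the leading part of the remainder
    refine ⟨fun i y => η i y + ∑ s : Increasing p q × MultiIndex q k,
        v (i, s) • elemForm (u i m) s.1 s.2.1 y, fun i => (hη i).add ?_, ?_⟩
    · exact Finset.analyticAt_fun_sum _ fun s _ =>
        analyticAt_smul_form analyticAt_const (analyticAt_elemForm _ _ _ _)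
    · refine (hc.sub (sum_pullback_isBigO hu v)).congr_left fun z => ?_
      have : ∀ i, pullback (u i) (fun y => η i y + ∑ s : Increasing p q × MultiIndex q k,
          v (i, s) • elemForm (u i m) s.1 s.2.1 y) z = pullback (u i) (η i) z + pullback (u i)
            (fun y => ∑ s : Increasing p q × MultiIndex q k,
              v (i, s) • elemForm (u i m) s.1 s.2.1 y) z := fun i => rfl
      simp only [this, Finset.sum_add_distrib, hv]
      abel

/-- If the matrices `P_h`, `h ≥ k`, have maximal column rank, an abelian relation which vanishes to
order `k` vanishes to infinite order. -/
theorem isBigO_of_sum_pullback_eq_zero {u : Fin d → (Fin n → ℂ) → (Fin q → ℂ)} {m : Fin n → ℂ}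
    (hu : ∀ i, AnalyticAt ℂ (u i) m) {p k : ℕ} {η : Fin d → (Fin q → ℂ) → Cov q p}
    (hη : ∀ i, AnalyticAt ℂ (η i) (u i m))
    (hP : ∀ h ≥ k, ∀ v, (matrixP (fun i => jacobian (u i) m) p h).mulVec v = 0 → v = 0)
    (hk : ∀ i, η i =O[𝓝 (u i m)] fun y => ‖y - u i m‖ ^ k)
    (hsum : ∀ᶠ z in 𝓝 m, ∑ i, pullback (u i) (η i) z = 0) (j : ℕ) :
    ∀ i, η i =O[𝓝 (u i m)] fun y => ‖y - u i m‖ ^ (k + j) := by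
  induction j with
  | zero => exact hk
  | succ j ih =>
    choose v hv using fun i => exists_leading_form (hη i) (k + j) (ih i)
    have h1 : (fun z => ∑ i, (pullback (u i) (η i) z - pullback (u i)
        (fun y => ∑ s, v i s • elemForm (u i m) s.1 s.2.1 y) z)) =O[𝓝 m]
          fun z => ‖z - m‖ ^ (k + j + 1) :=
      Asymptotics.IsBigO.fun_sum fun i _ => pullback_isBigO (hu i).contDiffAt (hv i)
    have h2 := sum_pullback_isBigO hu fun s : Fin d × Increasing p q × MultiIndex q (k + j) =>
      v s.1 s.2
    have h3 := (h1.add h2).neg_left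
    -- the leading part of the zero form is zero
    have h0 := leading_coeff_eq_zero (h3.congr' (by
      filter_upwards [hsum] with z hz
      simp only [Finset.sum_sub_distrib, hz]
      abel_nf
      rfl) Filter.EventuallyEq.rfl)
    have hv0 := hP _ (Nat.le_add_right k j) _ h0
    intro i
    refine (hv i).congr_left fun y => ?_
    have : ∀ s, v i s = 0 := fun s => congrFun hv0 (i, s)
    simp only [this, cov_zero_smul, Finset.sum_const_zero, sub_zero]

/-! ### The kernel of an analytic family of surjections -/

/-- Let `S x : V → T` be linear maps depending analytically on `x`, with `S m` onto. The kernels of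
the `S x`, `x` near `m`, transported by injections `Φ x`, have an analytic frame: if `R` is a right
inverse of `S m`, then `π x = 1 - R (S x R)⁻¹ S x` is a projector onto the kernel of `S x`, and it
induces an isomorphism from the kernel of `S m`. -/
theorem exists_analytic_frame {E V J F : Type*} [NormedAddCommGroup E] [NormedSpace ℂ E]
    [NormedAddCommGroup V] [NormedSpace ℂ V] [FiniteDimensional ℂ V]
    [NormedAddCommGroup J] [NormedSpace ℂ J] [NormedAddCommGroup F] [NormedSpace ℂ F]
    [CompleteSpace F] {m : E} {S : E → V →L[ℂ] J} (hS : AnalyticAt ℂ S m)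
    (T : Submodule ℂ J) [FiniteDimensional ℂ T]
    (hT : ∀ᶠ x in 𝓝 m, ∀ v, S x v ∈ T) (hsurj : ∀ t ∈ T, ∃ v, S m v = t)
    {Φ : E → V →L[ℂ] F} (hΦ : AnalyticAt ℂ Φ m) (hinj : ∀ᶠ x in 𝓝 m, Function.Injective (Φ x))
    {r : ℕ} (hr : r + Module.finrank ℂ T = Module.finrank ℂ V) :
    ∃ s : Fin r → E → F, ∀ᶠ x in 𝓝 m, (∀ j, AnalyticAt ℂ (s j) x) ∧
      LinearIndependent ℂ (fun j => s j x) ∧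
        Submodule.span ℂ (Set.range fun j => s j x) =
          (LinearMap.ker (S x : V →ₗ[ℂ] J)).map (Φ x : V →ₗ[ℂ] F) := by
  obtain ⟨Q, hQ⟩ := Submodule.ClosedComplemented.of_finiteDimensional T
  have : CompleteSpace T := FiniteDimensional.complete ℂ T
  -- `S` with values in `T`, up to the choice of a projector onto `T`
  let S' : E → V →L[ℂ] T := fun x => Q.comp (S x)
  have hS' : AnalyticAt ℂ S' m :=
    ((ContinuousLinearMap.compL ℂ V J T Q).analyticAt (S m)).comp hS
  have hsurj' : Function.Surjective (S' m) := fun t => by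
    obtain ⟨v, hv⟩ := hsurj t t.2
    exact ⟨v, by simp only [S', ContinuousLinearMap.comp_apply, hv, hQ]⟩
  have hker : ∀ᶠ x in 𝓝 m, ∀ v, S' x v = 0 ↔ S x v = 0 := by
    filter_upwards [hT] with x hx v
    have e : (S' x v : J) = S x v := congrArg Subtype.val (hQ ⟨S x v, hx v⟩)
    rw [← e, Submodule.coe_eq_zero]
  obtain ⟨R₀, hR₀⟩ := (S' m : V →ₗ[ℂ] T).exists_rightInverse_of_surjective
    (LinearMap.range_eq_top.2 hsurj')
  let R : T →L[ℂ] V := R₀.toContinuousLinearMap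
  have hR : ∀ t, S' m (R t) = t := fun t => congrArg (fun L => L t) hR₀
  let A : E → T →L[ℂ] T := fun x => (S' x).comp R
  have hA : AnalyticAt ℂ A m :=
    (((ContinuousLinearMap.compL ℂ T V T).flip R).analyticAt (S' m)).comp hS'
  have hAm : A m = 1 := by ext t; simp [A, hR]
  have hunit : ∀ᶠ x in 𝓝 m, IsUnit (A x) :=
    hA.continuousAt.eventually (by rw [hAm]; exact Units.nhds (R := T →L[ℂ] T) 1)
  let B : E → T →L[ℂ] T := fun x => Ring.inverse (A x)
  have hB : AnalyticAt ℂ B m := by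
    have h1 : AnalyticAt ℂ (Ring.inverse : (T →L[ℂ] T) → (T →L[ℂ] T)) (A m) := by
      rw [hAm]
      exact analyticAt_inverse (𝕜 := ℂ) (A := T →L[ℂ] T) 1
    exact h1.comp hA
  have hAB : ∀ᶠ x in 𝓝 m, (∀ t, A x (B x t) = t) ∧ ∀ t, B x (A x t) = t := by
    filter_upwards [hunit] with x hx
    exact ⟨fun t => congrArg (fun L : T →L[ℂ] T => L t) (Ring.mul_inverse_cancel _ hx),
      fun t => congrArg (fun L : T →L[ℂ] T => L t) (Ring.inverse_mul_cancel _ hx)⟩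
  let π : E → V →L[ℂ] V := fun x => ContinuousLinearMap.id ℂ V - R.comp ((B x).comp (S' x))
  have hπ : AnalyticAt ℂ π m := by
    refine analyticAt_const.sub ?_
    refine ((ContinuousLinearMap.compL ℂ V T V R).analyticAt _).comp ?_
    exact (ContinuousLinearMap.compL ℂ V T T).analyticAt_bilinear _ |>.comp₂ hB hS'
  have hπv : ∀ x v, π x v = v - R (B x (S' x v)) := fun x v => rfl
  let N := LinearMap.ker (S' m : V →ₗ[ℂ] T)
  have hN : Module.finrank ℂ N = r := by
    have e := (S' m : V →ₗ[ℂ] T).finrank_range_add_finrank_ker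
    rw [LinearMap.range_eq_top.2 hsurj', finrank_top] at e
    change Module.finrank ℂ T + Module.finrank ℂ N = _ at e
    omega
  let e : Module.Basis (Fin r) ℂ N := Module.finBasisOfFinrankEq ℂ N hN
  refine ⟨fun j x => Φ x (π x (e j)), ?_⟩
  filter_upwards [hΦ.eventually_analyticAt, hπ.eventually_analyticAt, hker, hAB, hinj] with
    x h1 h2 h3 h4 h5
  let L : N →ₗ[ℂ] F := ((Φ x).comp (π x) : V →ₗ[ℂ] F).comp N.subtype
  refine ⟨fun j => ?_, ?_, ?_⟩
  · have h6 : AnalyticAt ℂ (fun x => π x (e j : V)) x :=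
      ((ContinuousLinearMap.apply ℂ V (e j : V)).analyticAt (π x)).comp h2
    exact ((ContinuousLinearMap.id ℂ (V →L[ℂ] F)).analyticAt_bilinear (Φ x, π x (e j))).comp₂ h1 h6
  · have hL : LinearMap.ker L = ⊥ := by
      refine LinearMap.ker_eq_bot'.2 fun w hw => ?_
      have hw1 : π x w = 0 := h5 (hw.trans (map_zero _).symm)
      have hw2 : (w : V) = R (B x (S' x w)) := sub_eq_zero.1 ((hπv x w).symm.trans hw1)
      have hw3 : S' m w = 0 := w.2
      rw [hw2, hR] at hw3
      rw [hw3, map_zero] at hw2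
      exact Subtype.ext hw2
    exact e.linearIndependent.map' L hL
  · have e1 : (Set.range fun j => Φ x (π x (e j))) = L '' Set.range e := by
      rw [← Set.range_comp]; rfl
    rw [e1, Submodule.span_image, e.span_eq, Submodule.map_top]
    ext y
    simp only [LinearMap.mem_range, Submodule.mem_map, LinearMap.mem_ker]
    constructor
    · rintro ⟨w, rfl⟩
      refine ⟨π x w, (h3 _).1 ?_, rfl⟩
      rw [hπv, map_sub, sub_eq_zero]
      exact (h4.1 (S' x w)).symm
    · rintro ⟨v, hv, rfl⟩
      have hv0 : S' x v = 0 := (h3 v).2 hv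
      refine ⟨⟨v - R (S' m v), ?_⟩, ?_⟩
      · change S' m (v - R (S' m v)) = 0
        rw [map_sub, hR, sub_self]
      · change Φ x (π x (v - R (S' m v))) = Φ x v
        have : B x (S' x (R (S' m v))) = S' m v := h4.2 _
        rw [hπv, map_sub (S' x), hv0, zero_sub, map_neg, map_neg, this]
        congr 1
        abel

/-! ### Jets of forms -/

theorem jet_apply {n p k : ℕ} (ω : (Fin n → ℂ) → Cov n p) (x : Fin n → ℂ) (j : Fin (k + 1)) :
    jet k ω x j = iteratedFDeriv ℂ (j : ℕ) ω x := rfl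

instance (n p k : ℕ) : CompleteSpace (JetSpace n p k) :=
  inferInstanceAs (CompleteSpace ((j : Fin (k + 1)) →
    ContinuousMultilinearMap ℂ (fun _ : Fin (j : ℕ) => (Fin n → ℂ)) (Cov n p)))

theorem jet_congr {n p : ℕ} (k : ℕ) {ω η : (Fin n → ℂ) → Cov n p} {x : Fin n → ℂ}
    (h : ω =ᶠ[𝓝 x] η) : jet k ω x = jet k η x :=
  funext fun j => (h.iteratedFDeriv ℂ j).self_of_nhds

theorem jet_add {n p : ℕ} (k : ℕ) {ω η : (Fin n → ℂ) → Cov n p} {x : Fin n → ℂ}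
    (hω : AnalyticAt ℂ ω x) (hη : AnalyticAt ℂ η x) :
    jet k (fun z => ω z + η z) x = jet k ω x + jet k η x :=
  funext fun _ => iteratedFDeriv_add_apply hω.contDiffAt hη.contDiffAt

theorem jet_smul {n p : ℕ} (k : ℕ) (a : ℂ) {ω : (Fin n → ℂ) → Cov n p} {x : Fin n → ℂ}
    (hω : AnalyticAt ℂ ω x) : jet k (fun z => a • ω z) x = a • jet k ω x :=
  funext fun j => show iteratedFDeriv ℂ (j : ℕ) (a • ω) x = a • iteratedFDeriv ℂ (j : ℕ) ω x from
    iteratedFDeriv_const_smul_apply hω.contDiffAt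

theorem jet_zero {n p : ℕ} (k : ℕ) (x : Fin n → ℂ) :
    jet k (fun _ => (0 : Cov n p)) x = 0 :=
  funext fun j => congrFun (iteratedFDeriv_fun_zero (𝕜 := ℂ) (n := (j : ℕ))) x

theorem analyticAt_sum_smul_form {n p : ℕ} {I : Type*} (s : Finset I) (a : I → ℂ)
    {ω : I → (Fin n → ℂ) → Cov n p} {x : Fin n → ℂ} (hω : ∀ i, AnalyticAt ℂ (ω i) x) :
    AnalyticAt ℂ (fun z => ∑ i ∈ s, a i • ω i z) x :=
  Finset.analyticAt_fun_sum _ fun i _ => analyticAt_smul_form analyticAt_const (hω i)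

theorem jet_sum_smul {n p : ℕ} (k : ℕ) {I : Type*} (s : Finset I) (a : I → ℂ)
    {ω : I → (Fin n → ℂ) → Cov n p} {x : Fin n → ℂ} (hω : ∀ i, AnalyticAt ℂ (ω i) x) :
    jet k (fun z => ∑ i ∈ s, a i • ω i z) x = ∑ i ∈ s, a i • jet k (ω i) x := by
  classical
  induction s using Finset.induction_on with
  | empty => simpa using jet_zero k x
  | insert i s hi ih =>
    simp only [Finset.sum_insert hi]
    rw [jet_add k (analyticAt_smul_form analyticAt_const (hω i)) (analyticAt_sum_smul_form s a hω),
      jet_smul k _ (hω i), ih]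

theorem jet_eq_zero_iff {n p k : ℕ} {ω : (Fin n → ℂ) → Cov n p} {x : Fin n → ℂ}
    (hω : AnalyticAt ℂ ω x) : jet k ω x = 0 ↔ ω =O[𝓝 x] fun z => ‖z - x‖ ^ (k + 1) := by
  rw [← iteratedFDeriv_eq_zero_iff_isBigO hω]
  exact ⟨fun h j hj => congrFun h ⟨j, Nat.lt_succ_of_le hj⟩,
    fun h => funext fun j => h j (Nat.lt_succ_iff.1 j.2)⟩

theorem jet_eq_of_isBigO {n p k : ℕ} {ω η : (Fin n → ℂ) → Cov n p} {x : Fin n → ℂ}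
    (hω : AnalyticAt ℂ ω x) (hη : AnalyticAt ℂ η x)
    (h : (fun z => ω z - η z) =O[𝓝 x] fun z => ‖z - x‖ ^ (k + 1)) : jet k ω x = jet k η x := by
  have h1 := (jet_eq_zero_iff (hω.sub hη)).2 h
  have h2 := jet_add k (hω.sub hη) hη
  have h3 : (fun z => (ω - η) z + η z) = ω := funext fun z => sub_add_cancel _ _
  rw [h3, h1, zero_add] at h2
  exact h2

theorem analyticAt_jet {n p : ℕ} (k : ℕ) {ω : (Fin n → ℂ) → Cov n p} {x : Fin n → ℂ}
    (hω : AnalyticAt ℂ ω x) : AnalyticAt ℂ (jet k ω) x := by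
  have : AnalyticAt ℂ (fun z => fun j : Fin (k + 1) => iteratedFDeriv ℂ (j : ℕ) ω z) x :=
    analyticAt_pi_iff.2 fun j => AnalyticOnNhd.iteratedFDeriv_of_isOpen
      (s := {y | AnalyticAt ℂ ω y})
      (fun _ hy => hy) (isOpen_analyticAt ℂ ω) j x hω
  exact this

/-- The space of jets of order `k` of analytic `p`-forms; it does not depend on the point, which
is taken to be the origin. -/
noncomputable def analyticJets (n p k : ℕ) : Submodule ℂ (JetSpace n p k) :=
  LinearMap.range (Fintype.linearCombination ℂ
    fun s : Increasing p n × MultiIndexLE n k => jet k (elemForm 0 s.1 s.2.2.1) 0)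

theorem finrank_analyticJets (n p k : ℕ) : Module.finrank ℂ (analyticJets n p k) =
    Fintype.card (Increasing p n × MultiIndexLE n k) := by
  rw [analyticJets, LinearMap.finrank_range_of_inj, Module.finrank_fintype_fun_eq_card]
  refine (injective_iff_map_eq_zero _).2 fun c hc => ?_
  have ha : ∀ s : Increasing p n × MultiIndexLE n k,
    AnalyticAt ℂ (elemForm (0 : Fin n → ℂ) s.1 s.2.2.1) 0 := fun s => analyticAt_elemForm _ _ _ _
  rw [Fintype.linearCombination_apply, ← jet_sum_smul k Finset.univ c ha,
    jet_eq_zero_iff (analyticAt_sum_smul_form _ _ ha)] at hc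
  exact form_coeff_eq_zero hc

instance (n p k : ℕ) : FiniteDimensional ℂ (analyticJets n p k) := by
  unfold analyticJets; infer_instance

theorem jet_mem_analyticJets {n p k : ℕ} {ω : (Fin n → ℂ) → Cov n p} {x : Fin n → ℂ}
    (hω : AnalyticAt ℂ ω x) : jet k ω x ∈ analyticJets n p k := by
  have e : jet k ω x = jet k (fun z => ω (z + x)) 0 := funext fun j => by
    simp only [jet_apply, iteratedFDeriv_comp_add_right, zero_add]
  have hω' : AnalyticAt ℂ (fun z => ω (z + x)) 0 :=
    AnalyticAt.comp (g := ω) (f := fun z => z + x) (by simpa using hω)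
      (analyticAt_id.add analyticAt_const)
  obtain ⟨c, hc⟩ := exists_taylor_form hω' 0 k
  have ha : ∀ s : Increasing p n × MultiIndexLE n k,
    AnalyticAt ℂ (elemForm (0 : Fin n → ℂ) s.1 s.2.2.1) 0 := fun s => analyticAt_elemForm _ _ _ _
  refine ⟨c, ?_⟩
  rw [e, jet_eq_of_isBigO hω' (analyticAt_sum_smul_form _ _ ha) hc, jet_sum_smul k _ _ ha,
    Fintype.linearCombination_apply]

theorem exists_eq_jet {n p k : ℕ} {a : JetSpace n p k} (ha : a ∈ analyticJets n p k)
    (x : Fin n → ℂ) : ∃ ω : (Fin n → ℂ) → Cov n p, AnalyticAt ℂ ω x ∧ a = jet k ω x := by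
  obtain ⟨c, rfl⟩ := ha
  have h0 : ∀ y, ∀ s : Increasing p n × MultiIndexLE n k,
    AnalyticAt ℂ (elemForm (0 : Fin n → ℂ) s.1 s.2.2.1) y := fun y s => analyticAt_elemForm _ _ _ _
  let η : (Fin n → ℂ) → Cov n p := fun y =>
    ∑ s : Increasing p n × MultiIndexLE n k, c s • elemForm 0 s.1 s.2.2.1 y
  have hη : ∀ y, AnalyticAt ℂ η y := fun y => analyticAt_sum_smul_form _ _ (h0 y)
  refine ⟨fun z => η (z - x), ?_, ?_⟩
  · exact AnalyticAt.comp (g := η) (f := fun z => z - x) (hη _)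
      (analyticAt_id.sub analyticAt_const)
  · rw [Fintype.linearCombination_apply, ← jet_sum_smul k _ _ (h0 0)]
    funext j
    simp only [jet_apply, iteratedFDeriv_comp_sub, sub_self]
    rfl

/-! ### Formal abelian relations near a point -/

theorem analyticAt_sum_elemForm {p r : ℕ} {I : Type*} [Fintype I] (K : I → Fin r →₀ ℕ)
    (c : Increasing p r × I → ℂ) (y₁ y : Fin r → ℂ) :
    AnalyticAt ℂ (fun y => ∑ s, c s • elemForm y₁ s.1 (K s.2) y) y :=
  analyticAt_sum_smul_form _ _ fun _ => analyticAt_elemForm _ _ _ _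

/-- The basic jets at `x` are the jets of the pullbacks of polynomial forms. -/
theorem mem_basicJets_iff {F : Foliation n q U} {x : Fin n → ℂ} {u : (Fin n → ℂ) → (Fin q → ℂ)}
    (hu : IsDefining F x u) {p k : ℕ} (y₁ : Fin q → ℂ) (a : JetSpace n p k) :
    a ∈ basicJets F p k x ↔ ∃ c : Increasing p q × MultiIndexLE q k → ℂ,
      ∑ s, c s • jet k (pullback u (elemForm y₁ s.1 s.2.2.1)) x = a := by
  have hux := hu.self_of_nhds.1
  have key : ∀ c : Increasing p q × MultiIndexLE q k → ℂ,
      ∑ s, c s • jet k (pullback u (elemForm y₁ s.1 s.2.2.1)) x =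
        jet k (pullback u fun y => ∑ s, c s • elemForm y₁ s.1 s.2.2.1 y) x := fun c => by
    rw [← jet_sum_smul k Finset.univ c
      (ω := fun s : Increasing p q × MultiIndexLE q k => pullback u (elemForm y₁ s.1 s.2.2.1))
      fun s => analyticAt_pullback hux (analyticAt_elemForm _ _ _ _)]
    congr 1
    funext z
    exact (pullback_sum_smul _ _ _ _ _).symm
  simp only [key]
  constructor
  · rintro ⟨ω, hω, rfl⟩
    obtain ⟨η, hη, he⟩ := hω.exists_eq_pullback hu
    obtain ⟨c, hc⟩ := exists_taylor_form hη y₁ k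
    refine ⟨c, ?_⟩
    rw [jet_congr k he]
    refine (jet_eq_of_isBigO (analyticAt_pullback hux hη)
      (analyticAt_pullback hux (analyticAt_sum_elemForm (fun ι : MultiIndexLE q k => ι.2.1) _ _ _))
      ?_).symm
    exact pullback_isBigO hux.contDiffAt hc
  · rintro ⟨c, rfl⟩
    exact ⟨_, hu.isBasicNear_pullback
      (analyticAt_sum_elemForm (fun ι : MultiIndexLE q k => ι.2.1) _ _ _), rfl⟩

/-- A form and its pullback by a submersion have the same order of vanishing. -/
theorem isBigO_of_pullback_isBigO {u : (Fin n → ℂ) → (Fin q → ℂ)} {x : Fin n → ℂ}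
    (hu : AnalyticAt ℂ u x) (hs : Function.Surjective (fderiv ℂ u x)) {p k : ℕ}
    {η : (Fin q → ℂ) → Cov q p} (h : pullback u η =O[𝓝 x] fun z => ‖z - x‖ ^ k) :
    η =O[𝓝 (u x)] fun y => ‖y - u x‖ ^ k := by
  obtain ⟨s, hsa, hsx, hus⟩ := exists_section hu hs
  have h1 := pullback_isBigO (f := s) (x := u x) hsa.contDiffAt (ω := pullback u η) (k := k)
    (by rwa [hsx])
  refine h1.congr' ?_ Filter.EventuallyEq.rfl
  have hc : Filter.Tendsto s (𝓝 (u x)) (𝓝 x) := by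
    have := hsa.continuousAt
    rwa [ContinuousAt, hsx] at this
  filter_upwards [hsa.eventually_analyticAt, hc.eventually hu.eventually_analyticAt,
    hus.eventually_nhds] with y h2 h3 h4
  rw [pullback_pullback h3.differentiableAt h2.differentiableAt, pullback_eq_self h4]

/-- The jets of the pullbacks of the monomial forms are linearly independent. -/
theorem basicJet_coeff_eq_zero {u : (Fin n → ℂ) → (Fin q → ℂ)} {x : Fin n → ℂ}
    (hu : AnalyticAt ℂ u x) (hs : Function.Surjective (fderiv ℂ u x)) {p k : ℕ} (y₁ : Fin q → ℂ)
    {c : Increasing p q × MultiIndexLE q k → ℂ}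
    (h : ∑ s, c s • jet k (pullback u (elemForm y₁ s.1 s.2.2.1)) x = 0) : c = 0 := by
  rw [← jet_sum_smul k Finset.univ c
    (ω := fun s : Increasing p q × MultiIndexLE q k => pullback u (elemForm y₁ s.1 s.2.2.1))
    fun s => analyticAt_pullback hu (analyticAt_elemForm _ _ _ _)] at h
  simp only [← pullback_sum_smul] at h
  rw [jet_eq_zero_iff (analyticAt_pullback hu
    (analyticAt_sum_elemForm (fun ι : MultiIndexLE q k => ι.2.1) _ _ _))] at h
  exact form_coeff_eq_zero (isBigO_of_pullback_isBigO hu hs h)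

/-- If the matrices `P_0, …, P_k` have maximal row rank at `m`, the formal abelian relations of
order `k` form a holomorphic vector bundle near `m`. -/
theorem exists_frame_formalRelations (W : Web n q d U) {p k : ℕ} {m : Fin n → ℂ}
    {u : Fin d → (Fin n → ℂ) → (Fin q → ℂ)} (hu : ∀ i, IsDefining (W i) m (u i))
    (hP : ∀ h < k + 1, Function.Surjective (matrixP (fun i => jacobian (u i) m) p h).mulVec)
    {r : ℕ} (hr : r + Fintype.card (Increasing p n × MultiIndexLE n k) =
      Fintype.card (Fin d × Increasing p q × MultiIndexLE q k)) :
    ∃ s : Fin r → (Fin n → ℂ) → Fin d → JetSpace n p k, ∀ᶠ x in 𝓝 m,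
      (∀ j, AnalyticAt ℂ (s j) x) ∧ LinearIndependent ℂ (fun j => s j x) ∧
        Submodule.span ℂ (Set.range fun j => s j x) = formalRelations W p k x := by
  let I := Fin d × Increasing p q × MultiIndexLE q k
  let a : I → (Fin n → ℂ) → JetSpace n p k := fun s =>
    jet k (pullback (u s.1) (elemForm (u s.1 m) s.2.1 s.2.2.2.1))
  have hum : ∀ i, AnalyticAt ℂ (u i) m := fun i => (hu i).self_of_nhds.1
  have hω : ∀ (s : I) (x : Fin n → ℂ), AnalyticAt ℂ (u s.1) x →
      AnalyticAt ℂ (pullback (u s.1) (elemForm (u s.1 m) s.2.1 s.2.2.2.1)) x := fun s x hx =>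
    analyticAt_pullback hx (analyticAt_elemForm _ _ _ _)
  have ha : ∀ s, AnalyticAt ℂ (a s) m := fun s => analyticAt_jet k (hω s m (hum s.1))
  -- `Φ x` parametrizes the families of basic jets at `x`, and `S x` is the sum of such a family
  let S : (Fin n → ℂ) → (I → ℂ) →L[ℂ] JetSpace n p k := fun x =>
    ∑ s, (ContinuousLinearMap.proj (R := ℂ) (φ := fun _ : I => ℂ) s).smulRight (a s x)
  let Φ : (Fin n → ℂ) → (I → ℂ) →L[ℂ] (Fin d → JetSpace n p k) := fun x =>
    ∑ s, (ContinuousLinearMap.proj (R := ℂ) (φ := fun _ : I => ℂ) s).smulRight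
      (ContinuousLinearMap.single ℂ (fun _ : Fin d => JetSpace n p k) s.1 (a s x))
  have hS : AnalyticAt ℂ S m := Finset.analyticAt_fun_sum _ fun s _ =>
    ((ContinuousLinearMap.smulRightL ℂ (I → ℂ) (JetSpace n p k)
      (ContinuousLinearMap.proj s)).analyticAt (a s m)).comp (ha s)
  have hΦ : AnalyticAt ℂ Φ m := Finset.analyticAt_fun_sum _ fun s _ =>
    (((ContinuousLinearMap.smulRightL ℂ (I → ℂ) (Fin d → JetSpace n p k)
      (ContinuousLinearMap.proj s)).comp (ContinuousLinearMap.single ℂ _ s.1)).analyticAt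
        (a s m)).comp (ha s)
  have hSv : ∀ x v, S x v = ∑ s, v s • a s x := fun x v => by
    simp only [S, sum_apply]; rfl
  have hΦv : ∀ x v i, Φ x v i = ∑ t, v (i, t) • a (i, t) x := fun x v i => by
    have e : Φ x v i = ∑ s : I, v s • (Pi.single s.1 (a s x) : Fin d → JetSpace n p k) i := by
      simp only [Φ, sum_apply, Finset.sum_apply]; rfl
    rw [e, Fintype.sum_prod_type, Finset.sum_eq_single i]
    · simp
    · intro i' _ hi'
      refine Finset.sum_eq_zero fun t _ => ?_
      rw [Pi.single_eq_of_ne hi'.symm, smul_zero]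
    · simp
  have hev : ∀ᶠ x in 𝓝 m, ∀ i, IsDefining (W i) x (u i) :=
    Filter.eventually_all.2 fun i => Filter.Eventually.eventually_nhds (hu i)
  have hT : ∀ᶠ x in 𝓝 m, ∀ v, S x v ∈ analyticJets n p k := by
    filter_upwards [hev] with x hx v
    rw [hSv]
    exact Submodule.sum_mem _ fun s _ => Submodule.smul_mem _ _
      (jet_mem_analyticJets (hω s x (hx s.1).self_of_nhds.1))
  -- at `m` every jet is a sum of basic jets
  have hsurj : ∀ t ∈ analyticJets n p k, ∃ v, S m v = t := by
    intro t ht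
    obtain ⟨ω, hωm, rfl⟩ := exists_eq_jet ht m
    obtain ⟨η, hη, hO⟩ := exists_sum_pullback_isBigO hum hωm (k + 1) hP
    choose c hc using fun i => exists_taylor_form (hη i) (u i m) k
    refine ⟨fun s => c s.1 s.2, ?_⟩
    rw [hSv, ← jet_sum_smul k Finset.univ (fun s : I => c s.1 s.2) fun s => hω s m (hum s.1)]
    refine (jet_eq_of_isBigO hωm (analyticAt_sum_smul_form _ _ fun s => hω s m (hum s.1)) ?_).symm
    have h1 : (fun z => ∑ i, pullback (u i) (fun y => η i y -
        ∑ s : Increasing p q × MultiIndexLE q k, c i s • elemForm (u i m) s.1 s.2.2.1 y) z) =O[𝓝 m]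
          fun z => ‖z - m‖ ^ (k + 1) :=
      Asymptotics.IsBigO.fun_sum fun i _ => pullback_isBigO (hum i).contDiffAt (hc i)
    refine (hO.add h1).congr_left fun z => ?_
    have h2 : ∀ i, pullback (u i) (fun y => η i y -
        ∑ s : Increasing p q × MultiIndexLE q k, c i s • elemForm (u i m) s.1 s.2.2.1 y) z =
          pullback (u i) (η i) z - ∑ s : Increasing p q × MultiIndexLE q k,
            c i s • pullback (u i) (elemForm (u i m) s.1 s.2.2.1) z := fun i => by
      rw [← pullback_sum_smul]; rfl
    simp only [h2, Finset.sum_sub_distrib]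
    simp only [I, Fintype.sum_prod_type]
    abel
  have hinj : ∀ᶠ x in 𝓝 m, Function.Injective (Φ x) := by
    filter_upwards [hev] with x hx
    refine (injective_iff_map_eq_zero _).2 fun v hv => ?_
    funext ⟨i, t⟩
    have h1 := (hΦv x v i).symm.trans (congrFun hv i)
    exact congrFun (basicJet_coeff_eq_zero (c := fun t => v (i, t)) (hx i).self_of_nhds.1
      (hx i).self_of_nhds.2.1 (u i m) h1) t
  obtain ⟨s, hs⟩ := exists_analytic_frame (r := r) hS (analyticJets n p k) hT hsurj hΦ hinj (by
    rw [finrank_analyticJets, Module.finrank_fintype_fun_eq_card]; exact hr)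
  refine ⟨s, ?_⟩
  filter_upwards [hs, hev] with x hx hux
  refine ⟨hx.1, hx.2.1, hx.2.2.trans ?_⟩
  ext b
  simp only [Submodule.mem_map, LinearMap.mem_ker]
  have hsum : ∀ v, S x v = ∑ i, Φ x v i := fun v => by
    simp only [hSv, hΦv, I, Fintype.sum_prod_type]
  constructor
  · rintro ⟨v, hv, rfl⟩
    refine ⟨fun i => (mem_basicJets_iff (hux i) (u i m) _).2 ⟨fun t => v (i, t), (hΦv x v i).symm⟩,
      (hsum v).symm.trans hv⟩
  · rintro ⟨hb, hb0⟩
    choose c hc using fun i => (mem_basicJets_iff (hux i) (u i m) _).1 (hb i)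
    have e : Φ x (fun s => c s.1 s.2) = b := funext fun i => (hΦv x _ i).trans (hc i)
    refine ⟨fun s => c s.1 s.2, ?_, e⟩
    refine (hsum _).trans ?_
    rw [e, hb0]

/-! ### Numerical identities -/

theorem c_succ_mul {r : ℕ} (hr : 1 ≤ r) (h : ℕ) : c r (h + 1) * (h + 1) = c r h * (r + h) := by
  obtain ⟨r, rfl⟩ : ∃ s, r = s + 1 := ⟨r - 1, by omega⟩
  have e := Nat.add_one_mul_choose_eq (r + h) h
  simp only [c, b, Nat.add_sub_cancel, ← add_assoc]
  rw [← e]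
  ring

theorem c_pos {r : ℕ} (h : ℕ) : 0 < c r h := Nat.choose_pos (by omega)

/-- The quotients `c(n,h) / c(q,h)` are nondecreasing, since
`c(r,h+1) / c(r,h) = (r + h) / (h + 1)`. -/
theorem ratio_mono {n q p : ℕ} (hq : 1 ≤ q) (hpq : p ≤ q) (hqn : q ≤ n) :
    Monotone (ratio n q p) := by
  refine monotone_nat_of_le_succ fun h => ?_
  have hb : (0 : ℚ) < b q p := by exact_mod_cast Nat.choose_pos hpq
  have h1 : (0 : ℚ) < c q h := by exact_mod_cast c_pos h
  have h2 : (0 : ℚ) < c q (h + 1) := by exact_mod_cast c_pos (h + 1)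
  have key : c n h * c q (h + 1) ≤ c n (h + 1) * c q h := by
    refine Nat.le_of_mul_le_mul_right ?_ (Nat.succ_pos h)
    calc c n h * c q (h + 1) * (h + 1) = c n h * c q h * (q + h) := by
          rw [mul_assoc, c_succ_mul hq]; ring
      _ ≤ c n h * c q h * (n + h) := Nat.mul_le_mul_left _ (by omega)
      _ = c n (h + 1) * c q h * (h + 1) := by
          rw [mul_right_comm, ← c_succ_mul (hq.trans hqn)]; ring
  unfold ratio
  rw [div_le_div_iff₀ (mul_pos hb h1) (mul_pos hb h2)]
  have key' : (c n h : ℚ) * c q (h + 1) ≤ c n (h + 1) * c q h := by exact_mod_cast key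
  calc (b n p : ℚ) * c n h * (b q p * c q (h + 1))
      = b n p * b q p * (c n h * c q (h + 1)) := by ring
    _ ≤ b n p * b q p * (c n (h + 1) * c q h) := by gcongr
    _ = _ := by ring

theorem ratio_le_iff {n q p d h : ℕ} (hpq : p ≤ q) :
    ratio n q p h ≤ d ↔ b n p * c n h ≤ d * b q p * c q h := by
  have hb : (0 : ℚ) < b q p := by exact_mod_cast Nat.choose_pos hpq
  have h1 : (0 : ℚ) < c q h := by exact_mod_cast c_pos h
  rw [ratio, div_le_iff₀ (mul_pos hb h1), ← mul_assoc]
  exact_mod_cast Iff.rfl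

theorem card_multiIndexLE {r : ℕ} (hr : 1 ≤ r) (k : ℕ) :
    Fintype.card (MultiIndexLE r k) = ∑ h ∈ Finset.range (k + 1), c r h := by
  rw [Fintype.card_sigma, Finset.sum_range]
  exact Finset.sum_congr rfl fun h _ => card_multiIndex r h hr

theorem jetRank_eq {n q p d k : ℕ} (hpq : p ≤ q) :
    jetRank n q d p k =
      ∑ h ∈ Finset.range (k + 1), ((d * b q p * c q h : ℚ) - b n p * c n h) := by
  rw [jetRank, Finset.mul_sum]
  refine Finset.sum_congr rfl fun h _ => ?_
  have hb : (b q p : ℚ) ≠ 0 := by exact_mod_cast (Nat.choose_pos hpq).ne'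
  have h1 : (c q h : ℚ) ≠ 0 := by exact_mod_cast (c_pos h).ne'
  rw [ratio]
  field_simp

/-- Up to the critical order the rank of the bundle is the difference between the numbers of
columns and of rows of the matrices `P_0, …, P_k`. -/
theorem exists_rank_eq_jetRank {n q p d k : ℕ} (hq : 1 ≤ q) (hn : 1 ≤ n) (hpq : p ≤ q)
    (hk : ∀ h ≤ k, ratio n q p h ≤ d) :
    ∃ r : ℕ, (r : ℚ) = jetRank n q d p k ∧
      r + Fintype.card (Increasing p n × MultiIndexLE n k) =
        Fintype.card (Fin d × Increasing p q × MultiIndexLE q k) := by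
  have hle : ∀ h ∈ Finset.range (k + 1), b n p * c n h ≤ d * b q p * c q h := fun h hh =>
    (ratio_le_iff hpq).1 (hk h (Nat.lt_succ_iff.1 (Finset.mem_range.1 hh)))
  refine ⟨∑ h ∈ Finset.range (k + 1), (d * b q p * c q h - b n p * c n h), ?_, ?_⟩
  · rw [jetRank_eq hpq, Nat.cast_sum]
    refine Finset.sum_congr rfl fun h hh => ?_
    rw [Nat.cast_sub (hle h hh)]
    push_cast
    rfl
  · rw [Fintype.card_prod, Fintype.card_prod, Fintype.card_prod, card_increasing, card_increasing,
      card_multiIndexLE hn, card_multiIndexLE hq, Fintype.card_fin, Finset.mul_sum, Finset.mul_sum,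
      Finset.mul_sum, ← Finset.sum_add_distrib]
    refine Finset.sum_congr rfl fun h hh => ?_
    rw [Nat.sub_add_cancel (hle h hh), mul_assoc]

/-- The terms of order greater than the critical order do not contribute to the bound. -/
theorem rankBound_eq_jetRank {n q p d k : ℕ} (hk : ∀ h, h ≤ k ↔ ratio n q p h ≤ d) :
    rankBound n d q p = jetRank n q d p k := by
  rw [rankBound, jetRank]
  congr 1
  rw [finsum_eq_sum_of_support_subset (s := Finset.range (k + 1))]
  · refine Finset.sum_congr rfl fun h hh => ?_
    have := (hk h).1 (Nat.lt_succ_iff.1 (Finset.mem_range.1 hh))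
    rw [max_eq_left (sub_nonneg.2 this)]
  · intro h hh
    by_contra hc
    have h1 : ¬ h ≤ k := fun h' => hc (by simpa using Nat.lt_succ_of_le h')
    rw [hk, not_le] at h1
    exact hh (by simp [max_eq_right (sub_nonpos.2 h1.le)])

/-! ### Germs of abelian relations -/

/-- The jet of order `k` of a germ. -/
noncomputable def jetGerm {p : ℕ} (k : ℕ) {m : Fin n → ℂ} (σ : Filter.Germ (𝓝 m) (Cov n p)) :
    JetSpace n p k :=
  Filter.Germ.liftOn σ (fun ω => jet k ω m) fun _ _ h => jet_congr k h

theorem eventually_sum_eq_zero {p : ℕ} {m : Fin n → ℂ} {ω : Fin d → (Fin n → ℂ) → Cov n p}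
    (h : ∑ i, (ω i : Filter.Germ (𝓝 m) (Cov n p)) = 0) : ∀ᶠ z in 𝓝 m, ∑ i, ω i z = 0 := by
  have e := map_sum (Filter.Germ.coeAddHom (M := Cov n p) (𝓝 m)) ω Finset.univ
  have e2 : ((∑ i, ω i : (Fin n → ℂ) → Cov n p) : Filter.Germ (𝓝 m) (Cov n p)) = 0 := e.trans h
  filter_upwards [Filter.Germ.coe_eq.1 e2] with z hz
  simpa using hz

/-- The map sending a germ of abelian relation to its jet of order `k`. -/
noncomputable def jetRelation (W : Web n q d U) (p k : ℕ) (m : Fin n → ℂ) :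
    abelianRelations W p m →ₗ[ℂ] formalRelations W p k m where
  toFun σ := ⟨fun i => jetGerm k (σ.1 i), by
    obtain ⟨σ, hσ, hσ0⟩ := σ
    choose ω hω hωσ using id hσ
    obtain rfl : σ = fun i => (ω i : Filter.Germ (𝓝 m) (Cov n p)) := funext hωσ
    refine ⟨fun i => ⟨ω i, hω i, rfl⟩, ?_⟩
    have ha : ∀ i, AnalyticAt ℂ (ω i) m := fun i => (hω i).analyticAt
    have e := jet_sum_smul k Finset.univ (fun _ : Fin d => (1 : ℂ)) ha
    simp only [one_smul] at e
    refine e.symm.trans ?_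
    rw [jet_congr k (eventually_sum_eq_zero hσ0), jet_zero]⟩
  map_add' := by
    rintro ⟨σ, hσ, -⟩ ⟨τ, hτ, -⟩
    refine Subtype.ext (funext fun i => ?_)
    obtain ⟨ω, hω, h1⟩ := hσ i
    obtain ⟨η, hη, h2⟩ := hτ i
    change jetGerm k (σ i + τ i) = jetGerm k (σ i) + jetGerm k (τ i)
    rw [h1, h2]
    exact jet_add k hω.analyticAt hη.analyticAt
  map_smul' := by
    rintro a ⟨σ, hσ, -⟩
    refine Subtype.ext (funext fun i => ?_)
    obtain ⟨ω, hω, h1⟩ := hσ i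
    change jetGerm k (a • σ i) = a • jetGerm k (σ i)
    rw [h1]
    exact jet_smul k a hω.analyticAt

/-- If the matrices `P_h`, `h > k`, have maximal column rank at `m`, a germ at `m` of abelian
relation is determined by its jet of order `k`. -/
theorem jetRelation_injective (W : Web n q d U) {p k : ℕ} {m : Fin n → ℂ}
    {u : Fin d → (Fin n → ℂ) → (Fin q → ℂ)} (hu : ∀ i, IsDefining (W i) m (u i))
    (hP : ∀ h ≥ k + 1, ∀ v, (matrixP (fun i => jacobian (u i) m) p h).mulVec v = 0 → v = 0) :
    Function.Injective (jetRelation W p k m) := by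
  refine (injective_iff_map_eq_zero _).2 ?_
  intro σ h0
  choose ω hω hωσ using σ.2.1
  have hum : ∀ i, AnalyticAt ℂ (u i) m := fun i => (hu i).self_of_nhds.1
  choose η hη he using fun i => (hω i).exists_eq_pullback (hu i)
  have hjet : ∀ i, jet k (ω i) m = 0 := fun i => by
    have e : jetGerm k (σ.1 i) = 0 := congrFun (congrArg Subtype.val h0) i
    rwa [hωσ i] at e
  have hσ0 : ∑ i, (ω i : Filter.Germ (𝓝 m) (Cov n p)) = 0 :=
    (Finset.sum_congr rfl fun i _ => (hωσ i).symm).trans σ.2.2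
  have hO : ∀ i, η i =O[𝓝 (u i m)] fun y => ‖y - u i m‖ ^ (k + 1) := fun i => by
    refine isBigO_of_pullback_isBigO (hum i) (hu i).self_of_nhds.2.1 ?_
    exact ((jet_eq_zero_iff (hω i).analyticAt).1 (hjet i)).congr' (he i) Filter.EventuallyEq.rfl
  have hsum : ∀ᶠ z in 𝓝 m, ∑ i, pullback (u i) (η i) z = 0 := by
    filter_upwards [eventually_sum_eq_zero hσ0, Filter.eventually_all.2 he] with z h1 h2
    rw [← h1]
    exact Finset.sum_congr rfl fun i _ => (h2 i).symm
  refine Subtype.ext (funext fun i => (hωσ i).trans (Filter.Germ.coe_eq.2 ?_))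
  -- `η i` vanishes to infinite order
  have hall : ∀ j : ℕ, η i =O[𝓝 (u i m)] fun y => ‖y - u i m‖ ^ j := fun j =>
    (isBigO_of_sum_pullback_eq_zero hum hη hP hO hsum j i).trans
      (isBigO_pow_of_le (Nat.le_add_left j (k + 1)))
  filter_upwards [he i, (hum i).continuousAt.eventually
    (eventually_eq_zero_of_forall_isBigO (hη i) hall)] with z h1 h2
  rw [h1]
  ext w
  rw [pullback_apply, h2]
  rfl

end OrdinaryWeb

theorem mainTheorem1 (n q d p : ℕ) (hp : 1 ≤ p) (hpq : p ≤ q) (hq : 1 < q) (hqn : q ≤ n - 1)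
    (hd : (OrdinaryWeb.b n p : ℚ) / (OrdinaryWeb.b q p : ℚ) < (d : ℚ))
    (U : Set (Fin n → ℂ)) (hU : IsOpen U) (W : OrdinaryWeb.Web n q d U)
    (hW : OrdinaryWeb.IsOrdinary W p) :
    (∀ k : ℕ, k ≤ OrdinaryWeb.criticalOrder n q d p →
      ∃ r : ℕ, (r : ℚ) = OrdinaryWeb.jetRank n q d p k ∧
        OrdinaryWeb.IsHolomorphicSubbundle U (OrdinaryWeb.formalRelations W p k) r) ∧
    (∃ r : ℕ, OrdinaryWeb.pRank W p = (r : ℕ∞) ∧ (r : ℚ) ≤ OrdinaryWeb.rankBound n d q p) := by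
  open OrdinaryWeb in
  have hgr := isGreatest_criticalOrder hp hpq (by omega) hd.le
  set k₀ := criticalOrder n q d p
  have hk₀ : ∀ h, h ≤ k₀ ↔ ratio n q p h ≤ d := fun h =>
    ⟨fun hh => (ratio_mono (by omega) hpq (by omega) hh).trans hgr.1, fun hh => hgr.2 hh⟩
  have hrow : ∀ h, Fintype.card (Increasing p n × MultiIndex n h) = b n p * c n h := fun h => by
    rw [Fintype.card_prod, card_increasing, card_multiIndex _ _ (by omega)]
  have hcol : ∀ h, Fintype.card (Fin d × Increasing p q × MultiIndex q h) = d * b q p * c q h :=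
    fun h => by
      rw [Fintype.card_prod, Fintype.card_prod, card_increasing, card_multiIndex _ _ (by omega),
        Fintype.card_fin, mul_assoc]
  -- up to the critical order the matrices `P_h` are onto, beyond it they are injective
  have hord : ∀ m ∈ U, ∃ u : Fin d → (Fin n → ℂ) → (Fin q → ℂ), (∀ i, IsDefining (W i) m (u i)) ∧
      (∀ h ≤ k₀, Function.Surjective (matrixP (fun i => jacobian (u i) m) p h).mulVec) ∧
      ∀ h ≥ k₀ + 1, ∀ v, (matrixP (fun i => jacobian (u i) m) p h).mulVec v = 0 → v = 0 := by
    intro m hm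
    obtain ⟨u, hu, hr⟩ := hW m hm
    refine ⟨u, fun i => (hu i).isDefining hm, fun h hh => ?_, fun h hh => ?_⟩
    · refine mulVec_surjective_of_rank _ ?_
      rw [hr, hrow, min_eq_left ((ratio_le_iff hpq).1 ((hk₀ h).1 hh))]
    · refine mulVec_injective_of_rank _ ?_
      have h1 : ¬ h ≤ k₀ := by omega
      rw [hk₀, ratio_le_iff hpq, not_le] at h1
      rw [hr, hcol, min_eq_right h1.le]
  have hbundle : ∀ k ≤ k₀, ∃ r : ℕ, (r : ℚ) = jetRank n q d p k ∧
      IsHolomorphicSubbundle U (formalRelations W p k) r := by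
    intro k hk
    obtain ⟨r, hr, hcard⟩ := exists_rank_eq_jetRank (n := n) (q := q) (p := p) (d := d) (k := k)
      (by omega) (by omega) hpq fun h hh => (hk₀ h).1 (hh.trans hk)
    refine ⟨r, hr, fun m hm => ?_⟩
    obtain ⟨u, hu, hs, -⟩ := hord m hm
    exact exists_frame_formalRelations W hu (fun h hh => hs h (by omega)) hcard
  refine ⟨hbundle, ?_⟩
  obtain ⟨r, hr, hb⟩ := hbundle k₀ le_rfl
  have hle : pRank W p ≤ (r : ℕ∞) := by
    refine iSup_le fun m => ?_
    obtain ⟨u, hu, -, hi⟩ := hord m m.2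
    have h1 := LinearMap.rank_le_of_injective _ (jetRelation_injective W hu hi)
    obtain ⟨s, hs⟩ := hb m m.2
    obtain ⟨-, hli, hspan⟩ := hs.self_of_nhds
    have h2 : Module.rank ℂ (formalRelations W p k₀ m) = r := by
      rw [← hspan, rank_span hli, Cardinal.mk_range_eq _ hli.injective, Cardinal.mk_fin]
    rw [h2] at h1
    simpa using Cardinal.toENat.monotone' h1
  obtain ⟨r', hr'⟩ := ENat.ne_top_iff_exists.1 (ne_top_of_le_ne_top (ENat.natCast_ne_top r) hle)
  refine ⟨r', hr'.symm, ?_⟩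
  rw [rankBound_eq_jetRank hk₀, ← hr]
  rw [← hr'] at hle
  exact_mod_cast hle
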